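/- **Setting.** Let $\mathbb T=\mathbb R/\mathbb Z$ with its quotient distance $d$ and normalised Lebesgue measure $\mathrm{Leb}$. A continuous map $T:\mathbb T\to\mathbb T$ is *expanding* if there are $\varepsilon>0$ and $K>1$ with $d(Tx,Ty)\ge K\,d(x,y)$ whenever $d(x,y)<\varepsilon$; it is *orientation-preserving* if its degree is at least $2$. A *pre-image selector* for $T$ is a map $\tau:\mathbb T\to\mathbb T$ with $T(\tau(x))=x$ for all $x$, whose set $D_\tau$ of discontinuities is finite and such that at each $x\in D_\tau$ the one-sided limits $y(x)=\lim_{z\searrow x}\tau(z)$ and $y'(x)=\lim_{z\nearrow x}\tau(z)$ exist, are distinct, and one of them equals $\tau(x)$. If $\tau$ has $p\ge 1$ discontinuities, the set $F=\overline{\tau(\mathbb T)}$ is called a *$p$-flower*. Let $\mathrm{Lip}$ be the real vector space of Lipschitz functions $\mathbb T\to\mathbb R$, and let $\mathrm{Lip}_F$ be the set of $f\in\mathrm{Lip}$ that can be Lipschitz flattened on $F$, i.e. for which there is a $\varphi\in\mathrm{Lip}$ such that $f+\varphi-\varphi\circ T$ is constant on $F$. Let $[a,b]$ denote the positively oriented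 closed arc from $a$ to $b$, and write $u<_a v$ if the positively oriented arc from $a$ to $u$ is shorter than that from $a$ to $v$ (lengths taken in $[0,1)$). Given a selector $\tau$ and a chosen $x_1\in D_\tau$, put, for $x\in D_\tau$, $I_x=[y(x),y'(x)]$ if $y(x)<_{y(x_1)}y'(x)$ and $I_x=[y'(x),y(x)]$ otherwise, and let $e_x=\sum_{n=0}^\infty\chi(\tau^n I_x)$, where $\chi(G)$ is the characteristic function of $G$. **Theorem.** Let $T:\mathbb T\to\mathbb T$ be an orientation-preserving Lipschitz expanding map and let $F$ be a $p$-flower for $T$. Then $\mathrm{Lip}_F$ is a linear subspace of $\mathrm{Lip}$ of codimension exactly $p$. Moreover, let $\tau$ be any pre-image selector for $T$ with $\overline{\tau(\mathbb T)}=F$, and let $x_1\in D_\tau$ be arbitrary. Then $\tau$ has exactly $p$ discontinuities; for each $x\in D_\tau$ the function $e_x$ is Lebesgue integrable; the $p$ maps $$L_x:\mathrm{Lip}\to\mathbb R,\qquad L_x(f)=\int e_x f'\,d\mathrm{Leb}=\int f'\,d\mu_x ,\qquad x\in D_\tau,$$ where $\mu_x$ is the absolutely continuous measure with density $e_x$,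 are well defined linear functionals (the integrals converge); these $p$ functionals are linearly independent; and $\mathrm{Lip}_F=\bigcap_{x\in D_\tau}\ker L_x$. -/

import Mathlib

open Filter Topology MeasureTheory
open scoped NNReal ENNReal

namespace Flower

noncomputable section

/-! The circle `ℝ / ℤ` is `UnitAddCircle`, with its quotient distance and with `volume`, the
normalised Lebesgue measure. -/

/-- A continuous self-map of the circle that locally expands distances by a factor `K > 1`. -/
def IsExpanding (T : UnitAddCircle → UnitAddCircle) : Prop :=
  Continuous T ∧ ∃ ε : ℝ, 0 < ε ∧ ∃ K : ℝ, 1 < K ∧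
    ∀ x y : UnitAddCircle, dist x y < ε → K * dist x y ≤ dist (T x) (T y)

/-- `T` has degree `k`: it has a continuous lift `S : ℝ → ℝ` with `S (s + 1) = S s + k`. -/
def HasDegree (T : UnitAddCircle → UnitAddCircle) (k : ℤ) : Prop :=
  ∃ S : ℝ → ℝ, Continuous S ∧ (∀ s : ℝ, ((S s : ℝ) : UnitAddCircle) = T (s : UnitAddCircle)) ∧
    ∀ s : ℝ, S (s + 1) = S s + k

/-- An expanding circle map is orientation-preserving when its degree is at least `2`. -/
def IsOrientationPreservingExpanding (T : UnitAddCircle → UnitAddCircle) : Prop :=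
  IsExpanding T ∧ ∃ k : ℤ, 2 ≤ k ∧ HasDegree T k

/-- The length, in `[0, 1)`, of the positively oriented arc from `a` to `u`. -/
def arcLength (a u : UnitAddCircle) : ℝ :=
  (AddCircle.equivIco (1 : ℝ) 0 (u - a) : ℝ)

/-- The ordering `u <ₐ v` of the circle cut at `a`. -/
def CutLT (a u v : UnitAddCircle) : Prop :=
  arcLength a u < arcLength a v

/-- The positively oriented closed arc `[a, b]`. -/
def closedArc (a b : UnitAddCircle) : Set UnitAddCircle :=
  {t | arcLength a t ≤ arcLength a b}

/-- The set of discontinuities of a map. -/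
def discontinuities (τ : UnitAddCircle → UnitAddCircle) : Set UnitAddCircle :=
  {x | ¬ ContinuousAt τ x}

/-- Both one-sided limits at `x` exist, they are distinct, and one of them is the value at `x`. -/
def IsJump (τ : UnitAddCircle → UnitAddCircle) (x : UnitAddCircle) : Prop :=
  ∃ l r : UnitAddCircle,
    Tendsto (fun s : ℝ => τ (x + (s : UnitAddCircle))) (𝓝[<] 0) (𝓝 l) ∧
    Tendsto (fun s : ℝ => τ (x + (s : UnitAddCircle))) (𝓝[>] 0) (𝓝 r) ∧
    l ≠ r ∧ (τ x = l ∨ τ x = r)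

/-- A pre-image selector for `T`: a right inverse of `T` with only finitely many discontinuities,
all of them jumps. -/
def IsPreimageSelector (T τ : UnitAddCircle → UnitAddCircle) : Prop :=
  (∀ x, T (τ x) = x) ∧ (discontinuities τ).Finite ∧ ∀ x ∈ discontinuities τ, IsJump τ x

/-- `F` is a `p`-flower for `T`: the closure of the image of a pre-image selector with exactly
`p ≥ 1` discontinuities. -/
def IsFlower (T : UnitAddCircle → UnitAddCircle) (p : ℕ) (F : Set UnitAddCircle) : Prop :=
  1 ≤ p ∧ ∃ τ : UnitAddCircle → UnitAddCircle,
    IsPreimageSelector T τ ∧ (discontinuities τ).ncard = p ∧ F = closure (Set.range τ)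

/-- The right-hand limit `y(x)` of `τ` at `x`, a left endpoint of a petal. -/
def rightLim (τ : UnitAddCircle → UnitAddCircle) (x : UnitAddCircle) : UnitAddCircle :=
  limUnder (𝓝[>] (0 : ℝ)) (fun s : ℝ => τ (x + (s : UnitAddCircle)))

/-- The left-hand limit `y'(x)` of `τ` at `x`, a right endpoint of a petal. -/
def leftLim (τ : UnitAddCircle → UnitAddCircle) (x : UnitAddCircle) : UnitAddCircle :=
  limUnder (𝓝[<] (0 : ℝ)) (fun s : ℝ => τ (x + (s : UnitAddCircle)))

open Classical in
/-- The arc `I_x` between `y(x)` and `y'(x)`, for the circle cut at `y(x₁)`, where `x₁` is a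
chosen discontinuity of `τ`. -/
def arcI (τ : UnitAddCircle → UnitAddCircle) (x₁ x : UnitAddCircle) : Set UnitAddCircle :=
  if CutLT (rightLim τ x₁) (rightLim τ x) (leftLim τ x) then
    closedArc (rightLim τ x) (leftLim τ x)
  else
    closedArc (leftLim τ x) (rightLim τ x)

/-- `e_x = ∑ n, χ(τⁿ I_x)`, as a function with values in `[0, ∞]`. -/
def density (τ : UnitAddCircle → UnitAddCircle) (x₁ x : UnitAddCircle) :
    UnitAddCircle → ℝ≥0∞ :=
  fun t => ∑' n : ℕ, (τ^[n] '' arcI τ x₁ x).indicator (fun _ => (1 : ℝ≥0∞)) t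

/-- The vector space of real-valued Lipschitz functions on the circle. -/
def Lip : Submodule ℝ (UnitAddCircle → ℝ) where
  carrier := {f | ∃ C : ℝ≥0, LipschitzWith C f}
  add_mem' := by
    rintro f g ⟨C, hf⟩ ⟨D, hg⟩
    exact ⟨C + D, hf.add hg⟩
  zero_mem' := ⟨0, LipschitzWith.const 0⟩
  smul_mem' := by
    rintro c f ⟨C, hf⟩
    exact ⟨‖c‖₊ * C, (lipschitzWith_smul c).comp hf⟩

/-- The derivative of a function on the circle (zero where it does not exist). -/
def circleDeriv (f : UnitAddCircle → ℝ) (t : UnitAddCircle) : ℝ :=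
  deriv (fun s : ℝ => f (t + (s : UnitAddCircle))) 0

/-- `f` can be Lipschitz flattened on `F`: `f + φ - φ ∘ T` is constant on `F` for some Lipschitz
function `φ`. -/
def CanLipschitzFlatten (T : UnitAddCircle → UnitAddCircle) (F : Set UnitAddCircle)
    (f : UnitAddCircle → ℝ) : Prop :=
  ∃ φ ∈ Lip, ∃ c : ℝ, ∀ t ∈ F, f t + φ t - φ (T t) = c

/-- The set `Lip_F` of the Lipschitz functions that can be Lipschitz flattened on `F`. -/
def LipFlat (T : UnitAddCircle → UnitAddCircle) (F : Set UnitAddCircle) : Set Lip :=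
  {f | CanLipschitzFlatten T F f}

end

end Flower

/-! Flattening on F means f∘τ + φ∘τ - φ = c on the whole circle, by density of the range of τ in F.
Let w be the density of A ↦ Leb(τ(A)); expansion gives w ≤ K⁻¹ < 1. Let Q H = (H∘τ)·w (`transfer`),
so that ∫_A Q H = ∫_{τ(A)} H. Differentiating the flattening equation gives φ' = Q(f' + φ'), that
is, H = f' + Q H for H = f' + φ'. For any bounded H with f' = H - Q H, summing ∫_{τⁿ I_x} f' over n
telescopes, so L_x(f) = ∫_{I_x} H (`integral_visits_mul`). All three claims about the functionals
rest on this identity.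

Kernel. If f is flattened by φ, then f + φ takes the same value c + φ(x) at both endpoints of I_x,
so ∫_{I_x} H = 0 (`integral_eq_zero_of_flatten`). Conversely, solve H = f' + Q H by a Neumann series
and take φ to be a primitive of Q H. The flattening equation holds up to a locally constant error.
Vanishing of ∫_{I_x} H removes the jumps of that error at x ≠ x₁, and at x₁ it makes φ periodic
(`exists_flatten`).

Independence. Choose g with prescribed integrals over the arcs I_x and with integral zero off τ(𝕋).
Then g - Q g has integral zero, so it is the derivative a.e. of a Lipschitz f on the circle, and
L_x(f) = ∫_{I_x} g (`exists_integral_eq`). Hence the functionals are jointly onto ℝ^{D_τ}. This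
gives independence and codimension #D_τ; since the codimension depends on F alone, every selector
for F has p discontinuities. -/

namespace Flower

noncomputable section

/-! ### Contracting sections of a map and their transfer operator -/

section

/-- A measurable right inverse `τ` of `T` that contracts the measure `μ` by a factor `r < 1`. -/
structure IsContractingSection {X : Type*} [MeasurableSpace X] (μ : Measure X) (T τ : X → X)
    (r : ℝ≥0) : Prop where
  measurable_map : Measurable T
  measurable_section : Measurable τ
  rightInverse : ∀ x, T (τ x) = x
  lt_one : r < 1
  measurableSet_image : ∀ A, MeasurableSet A → MeasurableSet (τ '' A)
  measure_image_le : ∀ A, MeasurableSet A → μ (τ '' A) ≤ r * μ A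

namespace IsContractingSection

variable {X : Type*} [MeasurableSpace X] {μ : Measure X} {T τ : X → X} {r : ℝ≥0}

lemma image_eq (h : IsContractingSection μ T τ r) (A : Set X) :
    τ '' A = T ⁻¹' A ∩ Set.range τ := by
  ext y
  constructor
  · rintro ⟨x, hx, rfl⟩
    exact ⟨by simpa [h.rightInverse] using hx, x, rfl⟩
  · rintro ⟨hy, x, rfl⟩
    exact ⟨x, by simpa [h.rightInverse] using hy, rfl⟩

lemma measurableSet_range (h : IsContractingSection μ T τ r) : MeasurableSet (Set.range τ) := by
  rw [← Set.image_univ]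
  exact h.measurableSet_image _ MeasurableSet.univ

lemma measurableSet_iterate_image (h : IsContractingSection μ T τ r) {A : Set X}
    (hA : MeasurableSet A) (n : ℕ) : MeasurableSet (τ^[n] '' A) := by
  induction n with
  | zero => simpa using hA
  | succ n ih => rw [Function.iterate_succ', Set.image_comp]; exact h.measurableSet_image _ ih

lemma measure_iterate_image_le (h : IsContractingSection μ T τ r) {A : Set X}
    (hA : MeasurableSet A) (n : ℕ) : μ (τ^[n] '' A) ≤ r ^ n * μ A := by
  induction n with
  | zero => simp
  | succ n ih =>
    rw [Function.iterate_succ', Set.image_comp, pow_succ', mul_assoc]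
    exact (h.measure_image_le _ (h.measurableSet_iterate_image hA n)).trans
      (mul_le_mul_right ih _)

/-- The sum of the characteristic functions of the images of `A` under the iterates of `τ`. -/
def _root_.Flower.visits (τ : X → X) (A : Set X) (t : X) : ℝ≥0∞ :=
  ∑' n : ℕ, (τ^[n] '' A).indicator (fun _ => (1 : ℝ≥0∞)) t

lemma measurable_visits (h : IsContractingSection μ T τ r) {A : Set X} (hA : MeasurableSet A) :
    Measurable (visits τ A) :=
  Measurable.tsum fun n => measurable_const.indicator (h.measurableSet_iterate_image hA n)

/-- Integration over images under the section has a density bounded by the contraction factor. -/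
lemma exists_weight [IsFiniteMeasure μ] (h : IsContractingSection μ T τ r) :
    ∃ w : X → ℝ, Measurable w ∧ (∀ x, 0 ≤ w x ∧ w x ≤ r) ∧
      ∀ g : X → ℝ, Measurable g → ∀ A, MeasurableSet A →
        ∫ x in A, g (τ x) * w x ∂μ = ∫ x in τ '' A, g x ∂μ := by
  -- Since T undoes τ, τ '' A is the part of T⁻¹ A inside the range of τ; hence A ↦ μ (τ '' A) is
  -- this push-forward, in particular a measure.
  set ν : Measure X := (μ.restrict (Set.range τ)).map T with hν
  have hνA : ∀ A, MeasurableSet A → ν A = μ (τ '' A) := fun A hA => by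
    rw [hν, Measure.map_apply h.measurable_map hA, Measure.restrict_apply (h.measurable_map hA),
      h.image_eq]
  have hle : ∀ A, MeasurableSet A → ν A ≤ r * μ A := fun A hA => by
    rw [hνA A hA]; exact h.measure_image_le A hA
  have hac : ν ≪ μ := by
    refine Measure.AbsolutelyContinuous.mk fun A hA h0 => ?_
    simpa [h0] using hle A hA
  have hd : μ.withDensity (ν.rnDeriv μ) = ν := Measure.withDensity_rnDeriv_eq ν μ hac
  have hr : ∀ᵐ x ∂μ, ν.rnDeriv μ x ≤ r := by
    refine ae_le_of_forall_setLIntegral_le_of_sigmaFinite (Measure.measurable_rnDeriv ν μ)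
      fun s hs _ => ?_
    rw [← withDensity_apply _ hs, hd, setLIntegral_const]
    exact hle s hs
  -- The Radon–Nikodym derivative is at most r only almost everywhere; truncating at r makes the
  -- bound hold everywhere without changing any integral.
  refine ⟨fun x => min (ν.rnDeriv μ x).toReal r,
    (Measure.measurable_rnDeriv ν μ).ennreal_toReal.min measurable_const,
    fun x => ⟨le_min ENNReal.toReal_nonneg r.2, min_le_right _ _⟩, fun g hg A hA => ?_⟩
  have h1 : ∫ x in A, g (τ x) * min (ν.rnDeriv μ x).toReal r ∂μ
      = ∫ x in A, (ν.rnDeriv μ x).toReal • g (τ x) ∂μ := by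
    refine integral_congr_ae (ae_restrict_of_ae ?_)
    filter_upwards [hr] with x hx
    have : (ν.rnDeriv μ x).toReal ≤ r := ENNReal.toReal_le_of_le_ofReal r.2 (by simpa using hx)
    simp only [smul_eq_mul]
    rw [min_eq_left this, mul_comm]
  have h2 : ∫ x in A, (ν.rnDeriv μ x).toReal • g (τ x) ∂μ = ∫ x in A, g (τ x) ∂ν := by
    conv_rhs => rw [← hd]
    rw [setIntegral_withDensity_eq_setIntegral_toReal_smul (Measure.measurable_rnDeriv ν μ) _ _ hA]
    exact ae_restrict_of_ae (hr.mono fun x hx => hx.trans_lt ENNReal.coe_lt_top)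
  rw [h1, h2, hν, setIntegral_map (f := fun x => g (τ x)) hA
      (hg.comp h.measurable_section).aestronglyMeasurable h.measurable_map.aemeasurable,
    Measure.restrict_restrict (h.measurable_map hA), ← h.image_eq]
  refine setIntegral_congr_fun (h.measurableSet_image A hA) ?_
  rintro _ ⟨x, -, rfl⟩
  simp [h.rightInverse]

/-- The density of `A ↦ μ (τ '' A)`. -/
def weight [IsFiniteMeasure μ] (h : IsContractingSection μ T τ r) : X → ℝ :=
  h.exists_weight.choose

/-- The operator `g ↦ (g ∘ τ) · w`, dual to taking images under `τ`. -/
def transfer [IsFiniteMeasure μ] (h : IsContractingSection μ T τ r) (g : X → ℝ) : X → ℝ :=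
  fun x => g (τ x) * h.weight x

variable [IsFiniteMeasure μ]

lemma measurable_transfer (h : IsContractingSection μ T τ r) {g : X → ℝ} (hg : Measurable g) :
    Measurable (h.transfer g) :=
  (hg.comp h.measurable_section).mul h.exists_weight.choose_spec.1

lemma abs_transfer_le (h : IsContractingSection μ T τ r) {g : X → ℝ} {C : ℝ}
    (hg : ∀ x, |g x| ≤ C) (x : X) : |h.transfer g x| ≤ r * C := by
  obtain ⟨h0, h1⟩ : 0 ≤ h.weight x ∧ h.weight x ≤ r := h.exists_weight.choose_spec.2.1 x
  rw [transfer, abs_mul, mul_comm]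
  have h2 : |h.weight x| ≤ r := by rw [abs_of_nonneg h0]; exact h1
  exact mul_le_mul h2 (hg _) (abs_nonneg _) r.2

lemma setIntegral_transfer (h : IsContractingSection μ T τ r) {g : X → ℝ} (hg : Measurable g)
    {A : Set X} (hA : MeasurableSet A) :
    ∫ x in A, h.transfer g x ∂μ = ∫ x in τ '' A, g x ∂μ :=
  h.exists_weight.choose_spec.2.2 g hg A hA

/-- The equation `H = u + transfer H` has a bounded solution. -/
lemma exists_eq_add_transfer (h : IsContractingSection μ T τ r) {u : X → ℝ} (hu : Measurable u)
    {C : ℝ} (hC : ∀ x, |u x| ≤ C) :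
    ∃ H : X → ℝ, Measurable H ∧ (∃ C', ∀ x, |H x| ≤ C') ∧ ∀ x, H x = u x + h.transfer H x := by
  have hr1 : (r : ℝ) < 1 := by exact_mod_cast h.lt_one
  have hm : ∀ n, Measurable (h.transfer^[n] u) := fun n => by
    induction n with
    | zero => exact hu
    | succ n ih => rw [Function.iterate_succ_apply']; exact h.measurable_transfer ih
  have hb : ∀ n x, |h.transfer^[n] u x| ≤ r ^ n * C := fun n => by
    induction n with
    | zero => simpa using hC
    | succ n ih =>
      intro x
      rw [Function.iterate_succ_apply', pow_succ', mul_assoc]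
      exact h.abs_transfer_le ih x
  have hgs : Summable fun n : ℕ => (r : ℝ) ^ n * C :=
    (summable_geometric_of_lt_one r.2 hr1).mul_right C
  have hs : ∀ x, Summable fun n => h.transfer^[n] u x := fun x =>
    Summable.of_norm_bounded hgs fun n => hb n x
  -- The solution is the Neumann series, dominated by a geometric series of ratio r.
  refine ⟨fun x => ∑' n, h.transfer^[n] u x, ?_, ⟨∑' n : ℕ, (r : ℝ) ^ n * C, fun x => ?_⟩,
    fun x => ?_⟩
  · refine measurable_of_tendsto_metrizable (f := fun N x => ∑ n ∈ Finset.range N,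
      h.transfer^[n] u x) (fun N => Finset.measurable_fun_sum _ fun n _ => hm n) ?_
    exact tendsto_pi_nhds.2 fun x => (hs x).hasSum.tendsto_sum_nat
  · exact tsum_of_norm_bounded (f := fun n => h.transfer^[n] u x) hgs.hasSum fun n => hb n x
  · beta_reduce
    rw [(hs x).tsum_eq_zero_add]
    simp only [Function.iterate_zero, id_eq, Function.iterate_succ_apply', transfer]
    rw [tsum_mul_right]

/-- The n-th image has measure at most rⁿ μ A, so the integral is dominated by a convergent
geometric series. -/
lemma lintegral_visits_lt_top (h : IsContractingSection μ T τ r) {A : Set X}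
    (hA : MeasurableSet A) : ∫⁻ t, visits τ A t ∂μ < ∞ := by
  unfold visits
  rw [lintegral_tsum fun n =>
    (measurable_const.indicator (h.measurableSet_iterate_image hA n)).aemeasurable]
  simp only [lintegral_indicator_const (h.measurableSet_iterate_image hA _), one_mul]
  refine (ENNReal.tsum_le_tsum fun n => h.measure_iterate_image_le hA n).trans_lt ?_
  rw [ENNReal.tsum_mul_right, ENNReal.tsum_geometric]
  refine ENNReal.mul_lt_top ?_ (measure_lt_top μ A)
  rw [ENNReal.inv_lt_top]
  exact tsub_pos_of_lt (by exact_mod_cast h.lt_one)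

lemma integrable_visits_mul (h : IsContractingSection μ T τ r) {A : Set X}
    (hA : MeasurableSet A) {u : X → ℝ} (hu : Measurable u) {C : ℝ} (hC : ∀ x, |u x| ≤ C) :
    Integrable (fun t => (visits τ A t).toReal * u t) μ := by
  refine Integrable.mul_bdd (c := C) ?_ hu.aestronglyMeasurable (ae_of_all _ hC)
  exact integrable_toReal_of_lintegral_ne_top (h.measurable_visits hA).aemeasurable
    (h.lintegral_visits_lt_top hA).ne

/-- The integral of a coboundary `H - transfer H` against `visits τ A` telescopes. -/
lemma integral_visits_mul (h : IsContractingSection μ T τ r) {A : Set X}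
    (hA : MeasurableSet A) {u H : X → ℝ} (hH : Measurable H) {C : ℝ}
    (hC : ∀ x, |H x| ≤ C) (huH : ∀ᵐ x ∂μ, u x = H x - h.transfer H x) :
    ∫ t, (visits τ A t).toReal * u t ∂μ = ∫ t in A, H t ∂μ := by
  have hr1 : (r : ℝ) < 1 := by exact_mod_cast h.lt_one
  have hIH : Integrable H μ := Integrable.of_bound hH.aestronglyMeasurable C (ae_of_all _ hC)
  have hIQ : Integrable (h.transfer H) μ := Integrable.of_bound
    (h.measurable_transfer hH).aestronglyMeasurable (r * C) (ae_of_all _ (h.abs_transfer_le hC))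
  have hv : Measurable fun x => H x - h.transfer H x := hH.sub (h.measurable_transfer hH)
  have hvb : ∀ x, |H x - h.transfer H x| ≤ C + r * C := fun x =>
    (abs_sub _ _).trans (add_le_add (hC x) (h.abs_transfer_le hC x))
  set v : X → ℝ := fun x => H x - h.transfer H x with hvdef
  have hC0 : ∀ x : X, 0 ≤ C := fun x => (abs_nonneg _).trans (hC x)
  have hreal : ∀ n, μ.real (τ^[n] '' A) ≤ r ^ n * μ.real A := fun n => by
    have := ENNReal.toReal_mono (by finiteness) (h.measure_iterate_image_le hA n)
    simpa [Measure.real] using this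
  have hm := fun n => h.measurableSet_iterate_image hA n
  have e1 : ∫ t, (visits τ A t).toReal * u t ∂μ
      = ∫ t, ∑' n : ℕ, (τ^[n] '' A).indicator v t ∂μ := by
    refine integral_congr_ae (huH.mono fun t ht => ?_)
    simp only [visits]
    -- No finiteness of the sum is needed: at a point visited infinitely often `toReal` gives 0, and
    -- so does the non-summable real series.
    rw [ENNReal.tsum_toReal_eq fun n => by by_cases ht : t ∈ τ^[n] '' A <;> simp [ht],
      ← tsum_mul_right]
    refine tsum_congr fun n => ?_
    by_cases hmem : t ∈ τ^[n] '' A <;> simp only [hmem, Set.indicator_of_mem,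
      Set.indicator_of_notMem, not_false_eq_true, ENNReal.toReal_one, ENNReal.toReal_zero,
      one_mul, zero_mul, ht, hvdef]
  have hIv : Integrable v μ := hIH.sub hIQ
  have e2 : HasSum (fun n : ℕ => ∫ t in τ^[n] '' A, v t ∂μ)
      (∫ t, ∑' n : ℕ, (τ^[n] '' A).indicator v t ∂μ) := by
    have := hasSum_integral_of_summable_integral_norm (μ := μ)
      (F := fun (n : ℕ) t => (τ^[n] '' A).indicator v t) (fun n => hIv.indicator (hm n)) ?_
    · simpa only [integral_indicator (hm _)] using this
    · refine Summable.of_nonneg_of_le (fun n => integral_nonneg fun t => norm_nonneg _)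
        (fun n => ?_) ((summable_geometric_of_lt_one r.2 hr1).mul_right
          (μ.real A * (C + r * C)))
      simp only [norm_indicator_eq_indicator_norm]
      rw [integral_indicator (hm n)]
      calc ∫ t in τ^[n] '' A, ‖v t‖ ∂μ ≤ ∫ t in τ^[n] '' A, (C + r * C) ∂μ :=
            setIntegral_mono hIv.norm.integrableOn
              (integrable_const _) fun t => hvb t
        _ = μ.real (τ^[n] '' A) * (C + r * C) := by simp
        _ ≤ r ^ n * (μ.real A * (C + r * C)) := by
            rw [← mul_assoc]
            rcases isEmpty_or_nonempty X with hX | ⟨⟨x⟩⟩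
            · have : μ = 0 := Measure.eq_zero_of_isEmpty μ
              simp [this]
            · have := hC0 x
              gcongr
              exact hreal n
  -- By duality the integral of `transfer H` over one image is the integral of `H` over the next, so
  -- the series telescopes.
  have e3 : ∀ n : ℕ, ∫ t in τ^[n] '' A, v t ∂μ
      = ∫ t in τ^[n] '' A, H t ∂μ - ∫ t in τ^[n + 1] '' A, H t ∂μ := fun n => by
    rw [hvdef, integral_sub hIH.integrableOn hIQ.integrableOn, h.setIntegral_transfer hH (hm n),
      Function.iterate_succ', Set.image_comp]
  have e4 : Tendsto (fun n : ℕ => ∫ t in τ^[n] '' A, H t ∂μ) atTop (𝓝 0) := by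
    refine squeeze_zero_norm (a := fun n : ℕ => C * (r ^ n * μ.real A)) (fun n => ?_) ?_
    · refine (norm_setIntegral_le_of_norm_le_const (measure_lt_top μ _) fun x _ => hC x).trans ?_
      rcases isEmpty_or_nonempty X with hX | ⟨⟨x⟩⟩
      · have : μ = 0 := Measure.eq_zero_of_isEmpty μ
        simp [this]
      · exact mul_le_mul_of_nonneg_left (hreal n) (hC0 x)
    · simpa using ((tendsto_pow_atTop_nhds_zero_of_lt_one r.2 hr1).mul_const
        (μ.real A)).const_mul C
  rw [e1]
  refine tendsto_nhds_unique e2.tendsto_sum_nat ?_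
  simp only [e3]
  have := fun N => Finset.sum_range_sub' (fun n : ℕ => ∫ t in τ^[n] '' A, H t ∂μ) N
  simp only [this]
  simpa using e4.const_sub (∫ t in A, H t ∂μ)

end IsContractingSection

end

/-! ### Lifts of expanding maps; a preimage selector contracts Lebesgue measure -/

section

lemma coe_eq_coe_iff {s t : ℝ} :
    (s : UnitAddCircle) = (t : UnitAddCircle) ↔ ∃ n : ℤ, s = t + n := by
  rw [← sub_eq_zero, ← AddCircle.coe_sub, AddCircle.coe_eq_zero_iff]
  simp only [zsmul_eq_mul, mul_one]
  exact exists_congr fun n => ⟨fun h => by linarith, fun h => by linarith⟩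

lemma coe_add_intCast (s : ℝ) (n : ℤ) :
    ((s + n : ℝ) : UnitAddCircle) = (s : UnitAddCircle) :=
  coe_eq_coe_iff.2 ⟨n, rfl⟩

lemma continuous_coe : Continuous ((↑) : ℝ → UnitAddCircle) := AddCircle.continuous_mk' 1

lemma dist_coe_le (s t : ℝ) : dist (s : UnitAddCircle) (t : UnitAddCircle) ≤ |s - t| := by
  rw [dist_eq_norm, ← AddCircle.coe_sub]
  exact QuotientAddGroup.norm_mk_le_norm

lemma dist_coe_eq {s t : ℝ} (h : |s - t| ≤ 1 / 2) :
    dist (s : UnitAddCircle) (t : UnitAddCircle) = |s - t| := by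
  rw [dist_eq_norm, ← AddCircle.coe_sub, AddCircle.norm_coe_eq_abs_iff 1 one_ne_zero]
  simpa using h

/-- Points of the circle have lifts that realise their distance. -/
lemma exists_coe_eq_dist_eq (s : ℝ) (y : UnitAddCircle) :
    ∃ t : ℝ, (t : UnitAddCircle) = y ∧ |s - t| = dist (s : UnitAddCircle) y := by
  obtain ⟨u, rfl⟩ := QuotientAddGroup.mk_surjective y
  refine ⟨u + round (s - u), coe_add_intCast _ _, ?_⟩
  rw [dist_eq_norm, ← AddCircle.coe_sub, UnitAddCircle.norm_eq, sub_add_eq_sub_sub]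

/-- `S` is a lift, of degree `k`, of the expanding map `T`, and `R` is its inverse. -/
structure IsExpandingLift (T : UnitAddCircle → UnitAddCircle) (S R : ℝ → ℝ) (K : ℝ) (k : ℤ) :
    Prop where
  continuous_map : Continuous T
  exists_injective : ∃ ε : ℝ, 0 < ε ∧ ∀ x y, dist x y < ε → T x = T y → x = y
  continuous_lift : Continuous S
  coe_lift : ∀ s : ℝ, ((S s : ℝ) : UnitAddCircle) = T (s : UnitAddCircle)
  add_one : ∀ s, S (s + 1) = S s + k
  two_le : 2 ≤ k
  one_lt : 1 < K
  expand : ∀ s t, s ≤ t → K * (t - s) ≤ S t - S s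
  left_inv : ∀ s, R (S s) = s
  right_inv : ∀ s, S (R s) = s

/-- Local expansion controls only the absolute value of small increments of the lift. Connectedness
fixes their sign, the degree makes it positive, and subdivision turns the local estimate into a
global one. -/
lemma exists_isExpandingLift {T : UnitAddCircle → UnitAddCircle}
    (hT : IsOrientationPreservingExpanding T) :
    ∃ S R : ℝ → ℝ, ∃ K : ℝ, ∃ k : ℤ, IsExpandingLift T S R K k := by
  obtain ⟨⟨hTc, ε, hε, K, hK, hexp⟩, k, hk, S, hS, hST, hS1⟩ := hT
  have hK0 : 0 < K := by linarith
  -- The bound 1/2 ensures that the circle distance between s and s + h is h itself.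
  set δ : ℝ := min ε (1 / 2) with hδ
  have hδ0 : 0 < δ := lt_min hε (by norm_num)
  have hloc : ∀ s h : ℝ, 0 < h → h < δ → K * h ≤ |S (s + h) - S s| := fun s h h0 h1 => by
    have hd : dist ((s + h : ℝ) : UnitAddCircle) (s : UnitAddCircle) = h := by
      rw [dist_coe_eq] <;> rw [add_sub_cancel_left, abs_of_pos h0]
      exact h1.le.trans (min_le_right _ _)
    have h2 := hexp ((s + h : ℝ) : UnitAddCircle) (s : UnitAddCircle)
      (hd.trans_lt (h1.trans_le (min_le_left _ _)))
    rw [hd, ← hST, ← hST] at h2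
    exact h2.trans (dist_coe_le _ _)
  -- Increments with 0 < h < δ never vanish and (s, h) ranges over a connected set, so their sign is
  -- constant. It is positive because the m + 1 increments of step 1/(m + 1) over one period add up
  -- to k ≥ 2.
  have hpos : ∀ s h : ℝ, 0 < h → h < δ → 0 < S (s + h) - S s := by
    obtain ⟨m, hm⟩ := exists_nat_one_div_lt hδ0
    have hm0 : (0 : ℝ) < 1 / (m + 1) := by positivity
    obtain ⟨i, hi⟩ : ∃ i : ℕ, 0 < S (i * (1 / (m + 1)) + 1 / (m + 1)) - S (i * (1 / (m + 1))) := by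
      by_contra! hcon
      have h1 := Finset.sum_range_sub (fun i : ℕ => S (i * (1 / ((m : ℝ) + 1)))) (m + 1)
      have h2 : ∑ i ∈ Finset.range (m + 1), (S ((i + 1 : ℕ) * (1 / ((m : ℝ) + 1)))
          - S (i * (1 / ((m : ℝ) + 1)))) ≤ 0 := Finset.sum_nonpos fun i _ => by
        have := hcon i
        push_cast
        rwa [add_mul, one_mul]
      rw [h1] at h2
      have h3 : ((m + 1 : ℕ) : ℝ) * (1 / ((m : ℝ) + 1)) = 0 + 1 := by
        push_cast; field_simp; ring
      rw [h3, hS1] at h2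
      have : (2 : ℝ) ≤ k := by exact_mod_cast hk
      simp at h2
      linarith
    intro s h h0 h1
    by_contra! hcon
    have hpc : IsPreconnected (Set.univ ×ˢ Set.Ioo 0 δ : Set (ℝ × ℝ)) :=
      isPreconnected_univ.prod isPreconnected_Ioo
    have hF : Continuous fun q : ℝ × ℝ => S (q.1 + q.2) - S q.1 := by fun_prop
    obtain ⟨⟨a, b⟩, ⟨-, hb⟩, hab⟩ := hpc.intermediate_value
      (a := (s, h)) (b := ((i : ℝ) * (1 / (m + 1)), 1 / ((m : ℝ) + 1)))
      ⟨Set.mem_univ _, h0, h1⟩ ⟨Set.mem_univ _, hm0, hm⟩ hF.continuousOn ⟨hcon, hi.le⟩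
    have h2 := hloc a b hb.1 hb.2
    simp only at hab
    rw [hab, abs_zero] at h2
    have h3 := mul_pos hK0 hb.1
    linarith
  have hexpand : ∀ s t, s ≤ t → K * (t - s) ≤ S t - S s := fun s t hst => by
    obtain ⟨m, hm⟩ := exists_nat_gt ((t - s) / δ)
    have hm0 : (0 : ℝ) < m := (div_nonneg (sub_nonneg.2 hst) hδ0.le).trans_lt hm
    rcases hst.eq_or_lt with rfl | hlt
    · simp
    set h : ℝ := (t - s) / m with hh
    have h0 : 0 < h := div_pos (sub_pos.2 hlt) hm0
    have h1 : h < δ := by rw [hh, div_lt_iff₀ hm0]; rwa [div_lt_iff₀ hδ0, mul_comm] at hm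
    have hmh : m * h = t - s := by rw [hh]; field_simp
    have h2 := Finset.sum_range_sub (fun i : ℕ => S (s + i * h)) m
    have h3 : ∑ _i ∈ Finset.range m, K * h ≤ ∑ i ∈ Finset.range m,
        (S (s + (i + 1 : ℕ) * h) - S (s + i * h)) := Finset.sum_le_sum fun i _ => by
      have h4 := hloc (s + i * h) h h0 h1
      rw [abs_of_pos (hpos _ _ h0 h1)] at h4
      push_cast
      rwa [add_mul, one_mul, ← add_assoc]
    rw [h2, hmh] at h3
    simp only [Finset.sum_const, Finset.card_range, nsmul_eq_mul] at h3
    rw [mul_left_comm, hmh] at h3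
    simpa using h3
  have hsurj : Function.Surjective S := by
    refine hS.surjective ?_ ?_
    · refine tendsto_atTop_mono' (f₁ := fun t => K * t + S 0) _ ?_
        (tendsto_atTop_add_const_right _ _ (tendsto_id.const_mul_atTop hK0))
      filter_upwards [eventually_ge_atTop 0] with t ht
      have := hexpand 0 t ht
      linarith
    · refine tendsto_atBot_mono' (f₁ := fun t => K * t + S 0) _ ?_
        (tendsto_atBot_add_const_right _ _ (tendsto_id.const_mul_atBot hK0))
      filter_upwards [eventually_le_atBot 0] with t ht
      have := hexpand t 0 ht
      linarith
  have hinj : Function.Injective S := by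
    have hmono : StrictMono S := fun s t hst => by
      have h1 := hexpand s t hst.le
      have h2 := mul_pos hK0 (sub_pos.2 hst)
      linarith
    exact hmono.injective
  refine ⟨S, Function.surjInv hsurj, K, k, hTc, ⟨ε, hε, fun x y hxy hT => ?_⟩, hS, hST, hS1, hk, hK,
    hexpand, Function.leftInverse_surjInv ⟨hinj, hsurj⟩, Function.surjInv_eq hsurj⟩
  have h1 := hexp x y hxy
  rw [hT, dist_self] at h1
  exact dist_le_zero.1 (nonpos_of_mul_nonpos_right h1 hK0)

namespace IsExpandingLift

variable {T : UnitAddCircle → UnitAddCircle} {S R : ℝ → ℝ} {K : ℝ} {k : ℤ}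

lemma strictMono (h : IsExpandingLift T S R K k) : StrictMono S := fun s t hst => by
  have h1 := h.expand s t hst.le
  have h2 := mul_pos (zero_lt_one.trans h.one_lt) (sub_pos.2 hst)
  linarith

lemma strictMono_inv (h : IsExpandingLift T S R K k) : StrictMono R := fun s t hst => by
  rwa [← h.strictMono.lt_iff_lt, h.right_inv, h.right_inv]

lemma inv_sub_le (h : IsExpandingLift T S R K k) {s t : ℝ} (hst : s ≤ t) :
    R t - R s ≤ K⁻¹ * (t - s) := by
  have h1 := h.expand (R s) (R t) (h.strictMono_inv.monotone hst)
  rw [h.right_inv, h.right_inv] at h1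
  rwa [inv_mul_eq_div, le_div_iff₀ (zero_lt_one.trans h.one_lt), mul_comm]

lemma inv_sub_le_sub (h : IsExpandingLift T S R K k) {s t : ℝ} (hst : s ≤ t) :
    R t - R s ≤ t - s :=
  (h.inv_sub_le hst).trans
    (mul_le_of_le_one_left (sub_nonneg.2 hst) (inv_le_one_of_one_le₀ h.one_lt.le))

lemma lipschitzWith_inv (h : IsExpandingLift T S R K k) : LipschitzWith (K⁻¹).toNNReal R := by
  refine LipschitzWith.of_le_add_mul' _ fun s t => ?_
  rw [Real.dist_eq]
  rcases le_total s t with hst | hst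
  · have h1 := h.strictMono_inv.monotone hst
    have h2 : 0 ≤ K⁻¹ * |s - t| :=
      mul_nonneg (inv_nonneg.2 (zero_lt_one.trans h.one_lt).le) (abs_nonneg _)
    linarith
  · have h1 := h.inv_sub_le hst
    rw [abs_of_nonneg (sub_nonneg.2 hst)]
    linarith

lemma continuous_inv (h : IsExpandingLift T S R K k) : Continuous R :=
  h.lipschitzWith_inv.continuous

lemma add_intCast (h : IsExpandingLift T S R K k) (s : ℝ) (n : ℤ) : S (s + n) = S s + n * k := by
  have hp : Function.Periodic (fun s => S s - s * k) 1 := fun s => by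
    simp only [h.add_one]; ring
  have h1 := hp.int_mul n s
  simp only [mul_one] at h1
  linarith

lemma map_coe_inv (h : IsExpandingLift T S R K k) (t : ℝ) :
    T ((R t : ℝ) : UnitAddCircle) = (t : UnitAddCircle) := by
  rw [← h.coe_lift, h.right_inv]

end IsExpandingLift

/-- E may spread over many periods. Its pieces are translated into one fundamental domain, where
injectivity modulo 1 keeps them disjoint. -/
lemma volume_le_of_injOn {E : Set ℝ} (hE : MeasurableSet E)
    (hinj : Set.InjOn ((↑) : ℝ → UnitAddCircle) E) {A : Set UnitAddCircle}
    (hA : MeasurableSet A) (hEA : ∀ s ∈ E, (s : UnitAddCircle) ∈ A) : volume E ≤ volume A := by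
  have hfd := isAddFundamentalDomain_Ioc (zero_lt_one (α := ℝ)) 0
  have hvA : volume A = volume (((↑) : ℝ → UnitAddCircle) ⁻¹' A ∩ Set.Ioc 0 (0 + 1)) := by
    have hmp := UnitAddCircle.measurePreserving_mk 0
    rw [← hmp.measure_preimage hA.nullMeasurableSet,
      Measure.restrict_apply (hmp.measurable hA)]
  have hcoe : ∀ (g : AddSubgroup.zmultiples (1 : ℝ)) (x : ℝ),
      ((g +ᵥ x : ℝ) : UnitAddCircle) = (x : UnitAddCircle) := by
    rintro ⟨_, n, rfl⟩ x
    rw [coe_eq_coe_iff]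
    refine ⟨n, ?_⟩
    change (n • (1 : ℝ)) + x = x + n
    simp [add_comm]
  rw [hvA, hfd.measure_eq_tsum E, ← measure_iUnion]
  · refine measure_mono (Set.iUnion_subset fun g => ?_)
    rintro _ ⟨⟨x, hx, rfl⟩, h1⟩
    refine ⟨?_, h1⟩
    change ((g +ᵥ x : ℝ) : UnitAddCircle) ∈ A
    rw [hcoe]
    exact hEA x hx
  · intro g g' hgg'
    refine Set.disjoint_left.2 ?_
    rintro _ ⟨⟨x, hx, rfl⟩, -⟩ ⟨⟨y, hy, hxy⟩, -⟩
    apply hgg'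
    have h1 : x = y := hinj hx hy (by rw [← hcoe g x, ← hcoe g' y]; exact (congrArg _ hxy).symm)
    subst h1
    have h2 : (g' : ℝ) + x = (g : ℝ) + x := hxy
    exact Subtype.ext (by linarith)
  · exact fun g => (hE.const_vadd g).inter measurableSet_Ioc

variable {T τ : UnitAddCircle → UnitAddCircle}

lemma IsPreimageSelector.measurable (hτ : IsPreimageSelector T τ) : Measurable τ := by
  refine measurable_of_measurable_on_compl_finite _ hτ.2.1 (Continuous.measurable ?_)
  refine ContinuousOn.domRestrict fun x hx => ContinuousAt.continuousWithinAt ?_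
  simpa [discontinuities] using hx

/-- Lift τ '' A to a set E in one period. Then E is the image under the K⁻¹-Lipschitz map `R` of
S(E), and S(E) injects modulo 1 into A because `T` is injective on the range of τ. -/
lemma IsExpandingLift.isContractingSection {S R : ℝ → ℝ} {K : ℝ} {k : ℤ}
    (h : IsExpandingLift T S R K k) (hτ : IsPreimageSelector T τ) :
    IsContractingSection volume T τ (K⁻¹).toNNReal := by
  have him : ∀ A, MeasurableSet A → MeasurableSet (τ '' A) := fun A hA => by
    have : τ '' A = T ⁻¹' A ∩ {y | τ (T y) = y} := by
      ext y
      constructor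
      · rintro ⟨x, hx, rfl⟩
        exact ⟨by simpa [hτ.1] using hx, by simp [hτ.1]⟩
      · rintro ⟨hy, hyy⟩
        exact ⟨T y, hy, hyy⟩
    rw [this]
    exact (h.continuous_map.measurable hA).inter
      (measurableSet_eq_fun (hτ.measurable.comp h.continuous_map.measurable) measurable_id)
  refine ⟨h.continuous_map.measurable, hτ.measurable, hτ.1, ?_, him, fun A hA => ?_⟩
  · rw [← NNReal.coe_lt_coe, Real.coe_toNNReal _ (inv_nonneg.2 (zero_lt_one.trans h.one_lt).le)]
    simpa using inv_lt_one_of_one_lt₀ h.one_lt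
  have hmp := UnitAddCircle.measurePreserving_mk 0
  rw [← hmp.measure_preimage (him A hA).nullMeasurableSet,
    Measure.restrict_apply (hmp.measurable (him A hA))]
  set E : Set ℝ := ((↑) : ℝ → UnitAddCircle) ⁻¹' (τ '' A) ∩ Set.Ioc 0 (0 + 1) with hE
  have hEm : MeasurableSet E := (hmp.measurable (him A hA)).inter measurableSet_Ioc
  have hES : E = R '' (R ⁻¹' E) := by
    rw [Set.image_preimage_eq]
    exact fun s => ⟨S s, h.left_inv s⟩
  have hle : volume (R '' (R ⁻¹' E)) ≤ (K⁻¹).toNNReal * volume (R ⁻¹' E) := by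
    have := h.lipschitzWith_inv.hausdorffMeasure_image_le zero_le_one (R ⁻¹' E)
    simpa [hausdorffMeasure_real] using this
  rw [hES]
  refine hle.trans (mul_le_mul_right (volume_le_of_injOn
    (h.continuous_inv.measurable hEm) ?_ hA ?_) _)
  · intro s hs t ht hst
    obtain ⟨⟨x, hx, hxs⟩, hs1⟩ := hs
    obtain ⟨⟨y, hy, hyt⟩, ht1⟩ := ht
    have h1 : x = y := by
      rw [← hτ.1 x, ← hτ.1 y, hxs, hyt, h.map_coe_inv, h.map_coe_inv, hst]
    rw [h1, hyt] at hxs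
    refine h.strictMono_inv.injective ?_
    exact (AddCircle.coe_eq_coe_iff_of_mem_Ioc hs1 ht1).1 hxs.symm
  · rintro s ⟨⟨x, hx, hxs⟩, -⟩
    rwa [← h.map_coe_inv, ← hxs, hτ.1]

end

/-! ### Calculus on the circle and inverse branches at one-sided limits -/

section

lemma injOn_coe_Ioc (a : ℝ) :
    Set.InjOn ((↑) : ℝ → UnitAddCircle) (Set.Ioc a (a + 1)) :=
  fun _ hs _ ht h => (AddCircle.coe_eq_coe_iff_of_mem_Ioc hs ht).1 h

lemma measurableSet_coe_image {c : ℝ} {s : Set ℝ} (hs : MeasurableSet s)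
    (hsc : s ⊆ Set.Ioc c (c + 1)) : MeasurableSet (((↑) : ℝ → UnitAddCircle) '' s) :=
  hs.image_of_continuousOn_injOn continuous_coe.continuousOn ((injOn_coe_Ioc c).mono hsc)

lemma setIntegral_coe_image {c : ℝ} {s : Set ℝ} (hs : MeasurableSet s)
    (hsc : s ⊆ Set.Ioc c (c + 1)) {u : UnitAddCircle → ℝ} (hu : Measurable u) :
    ∫ x in ((↑) : ℝ → UnitAddCircle) '' s, u x = ∫ t in s, u (t : UnitAddCircle) := by
  have hmp := UnitAddCircle.measurePreserving_mk c
  have hm := measurableSet_coe_image hs hsc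
  conv_lhs => rw [← hmp.map_eq]
  rw [setIntegral_map hm hu.aestronglyMeasurable hmp.measurable.aemeasurable,
    Measure.restrict_restrict (hmp.measurable hm)]
  congr 2
  ext x
  constructor
  · rintro ⟨⟨t, ht, hts⟩, hx⟩
    rwa [← injOn_coe_Ioc c (hsc ht) hx hts]
  · exact fun hx => ⟨⟨x, hx, rfl⟩, hsc hx⟩

lemma Ioo_subset_Ioc_add_one {a b : ℝ} (hb : b ≤ a + 1) : Set.Ioo a b ⊆ Set.Ioc a (a + 1) :=
  fun _ hx => ⟨hx.1, hx.2.le.trans hb⟩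

lemma Icc_subset_Ioc_sub_one {a b : ℝ} (hb : b < a + 1) :
    Set.Icc a b ⊆ Set.Ioc (b - 1) (b - 1 + 1) :=
  fun _ hx => ⟨by linarith [hx.1], by linarith [hx.2]⟩

lemma setIntegral_coe_image_Ioo {a b : ℝ} (hab : a ≤ b) (hb : b ≤ a + 1)
    {u : UnitAddCircle → ℝ} (hu : Measurable u) :
    ∫ x in ((↑) : ℝ → UnitAddCircle) '' Set.Ioo a b, u x = ∫ s in a..b, u (s : UnitAddCircle) := by
  rw [setIntegral_coe_image measurableSet_Ioo (Ioo_subset_Ioc_add_one hb) hu,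
    intervalIntegral.integral_of_le hab, integral_Ioc_eq_integral_Ioo]

lemma setIntegral_coe_image_Icc {a b : ℝ} (hab : a ≤ b) (hb : b < a + 1)
    {u : UnitAddCircle → ℝ} (hu : Measurable u) :
    ∫ x in ((↑) : ℝ → UnitAddCircle) '' Set.Icc a b, u x = ∫ s in a..b, u (s : UnitAddCircle) := by
  rw [setIntegral_coe_image measurableSet_Icc (Icc_subset_Ioc_sub_one hb) hu,
    intervalIntegral.integral_of_le hab, integral_Icc_eq_integral_Ioc]

lemma ae_of_ae_coe {p : UnitAddCircle → Prop} (hp : MeasurableSet {x | p x})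
    (h : ∀ᵐ s : ℝ, p (s : UnitAddCircle)) : ∀ᵐ x, p x := by
  have hmp := UnitAddCircle.measurePreserving_mk 0
  rw [← hmp.map_eq, ae_map_iff hmp.measurable.aemeasurable hp]
  exact ae_restrict_of_ae h

lemma intervalIntegrable_coe {u : UnitAddCircle → ℝ} (hu : Measurable u) {C : ℝ}
    (hC : ∀ x, |u x| ≤ C) (a b : ℝ) :
    IntervalIntegrable (fun s : ℝ => u (s : UnitAddCircle)) volume a b := by
  refine (intervalIntegrable_const (c := C)).mono_fun
    (hu.comp continuous_coe.measurable).aestronglyMeasurable (ae_of_all _ fun s => ?_)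
  simpa using (hC _).trans (le_abs_self C)

lemma abs_integral_coe_le {u : UnitAddCircle → ℝ} {C : ℝ} (hC : ∀ x, |u x| ≤ C) (a b : ℝ) :
    |∫ s in a..b, u (s : UnitAddCircle)| ≤ C * |a - b| := by
  rw [abs_sub_comm]
  exact intervalIntegral.norm_integral_le_of_norm_le_const
    (f := fun s : ℝ => u (s : UnitAddCircle)) fun s _ => hC _

lemma mem_Lip_of_abs_le {f : UnitAddCircle → ℝ} {C : ℝ}
    (h : ∀ s t : ℝ, |f (s : UnitAddCircle) - f (t : UnitAddCircle)| ≤ C * |s - t|) : f ∈ Lip := by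
  refine ⟨C.toNNReal, LipschitzWith.of_dist_le_mul fun x y => ?_⟩
  obtain ⟨s, rfl⟩ := QuotientAddGroup.mk_surjective x
  obtain ⟨t, rfl, ht⟩ := exists_coe_eq_dist_eq s y
  refine (h s t).trans ?_
  rw [ht]
  exact mul_le_mul_of_nonneg_right (Real.le_coe_toNNReal C) dist_nonneg

lemma continuous_of_mem_Lip {f : UnitAddCircle → ℝ} (hf : f ∈ Lip) : Continuous f := by
  obtain ⟨C, hC⟩ := hf
  exact hC.continuous

lemma lipschitzWith_comp_coe {f : UnitAddCircle → ℝ} {C : ℝ≥0} (hf : LipschitzWith C f) :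
    LipschitzWith C fun s : ℝ => f (s : UnitAddCircle) := by
  refine LipschitzWith.of_dist_le_mul fun s t => (hf.dist_le_mul _ _).trans ?_
  rw [Real.dist_eq s t]
  exact mul_le_mul_of_nonneg_left (dist_coe_le s t) C.2

lemma circleDeriv_coe (f : UnitAddCircle → ℝ) (s : ℝ) :
    circleDeriv f (s : UnitAddCircle) = deriv (fun t : ℝ => f (t : UnitAddCircle)) s := by
  have := deriv_comp_const_add (f := fun t : ℝ => f (t : UnitAddCircle)) s 0
  simpa [circleDeriv] using this

lemma measurable_circleDeriv (f : UnitAddCircle → ℝ) : Measurable (circleDeriv f) := by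
  have h : circleDeriv f = (deriv fun t : ℝ => f (t : UnitAddCircle)) ∘ (↑) ∘
      (AddCircle.measurableEquivIco (1 : ℝ) 0) := by
    funext x
    simp only [Function.comp]
    rw [← circleDeriv_coe]
    congr 1
    exact (AddCircle.coe_equivIco (p := (1 : ℝ)) (a := 0)).symm
  rw [h]
  exact (measurable_deriv _).comp
    (measurable_subtype_coe.comp (AddCircle.measurableEquivIco (1 : ℝ) 0).measurable)

lemma exists_abs_circleDeriv_le {f : UnitAddCircle → ℝ} (hf : f ∈ Lip) :
    ∃ C, ∀ x, |circleDeriv f x| ≤ C := by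
  obtain ⟨C, hC⟩ := hf
  refine ⟨C, fun x => ?_⟩
  obtain ⟨s, rfl⟩ := QuotientAddGroup.mk_surjective x
  exact (congrArg abs (circleDeriv_coe f s)).trans_le
    (norm_deriv_le_of_lipschitz (lipschitzWith_comp_coe hC))

lemma integral_circleDeriv {f : UnitAddCircle → ℝ} (hf : f ∈ Lip) (a b : ℝ) :
    ∫ s in a..b, circleDeriv f (s : UnitAddCircle)
      = f (b : UnitAddCircle) - f (a : UnitAddCircle) := by
  obtain ⟨C, hC⟩ := hf
  simp only [circleDeriv_coe]
  exact ((lipschitzWith_comp_coe hC).lipschitzOnWith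
    (s := Set.uIcc a b)).absolutelyContinuousOnInterval.integral_deriv_eq_sub

/-- This is Lebesgue differentiation on the line, transferred to the circle. -/
lemma circleDeriv_ae_eq {f g : UnitAddCircle → ℝ} (hg : Measurable g) {C : ℝ}
    (hC : ∀ x, |g x| ≤ C) {a c : ℝ}
    (hf : ∀ t : ℝ, f (t : UnitAddCircle) = c + ∫ s in a..t, g (s : UnitAddCircle)) :
    ∀ᵐ x, circleDeriv f x = g x := by
  refine ae_of_ae_coe (measurableSet_eq_fun (measurable_circleDeriv f) hg) ?_
  have hloc : LocallyIntegrable (fun s : ℝ => g (s : UnitAddCircle)) volume :=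
    (locallyIntegrable_const C).mono (hg.comp continuous_coe.measurable).aestronglyMeasurable
      (ae_of_all _ fun s => (hC _).trans (le_abs_self C))
  filter_upwards [_root_.LocallyIntegrable.ae_hasDerivAt_integral hloc] with s hs
  rw [circleDeriv_coe]
  have : (fun t : ℝ => f (t : UnitAddCircle)) = fun t => c + ∫ s in a..t, g (s : UnitAddCircle) :=
    funext hf
  rw [this]
  exact ((hs a).const_add c).deriv

/-- A periodic primitive descends to a Lipschitz function on the circle. -/
lemma exists_primitive {g : UnitAddCircle → ℝ} (hg : Measurable g) {C : ℝ}
    (hC : ∀ x, |g x| ≤ C) {a : ℝ} (h0 : ∫ s in a..(a + 1), g (s : UnitAddCircle) = 0) :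
    ∃ f ∈ Lip, ∀ t : ℝ, f (t : UnitAddCircle) = ∫ s in a..t, g (s : UnitAddCircle) := by
  have hint := intervalIntegrable_coe hg hC
  have hper : Function.Periodic (fun t : ℝ => ∫ s in a..t, g (s : UnitAddCircle)) 1 := fun t => by
    have hg1 : Function.Periodic (fun s : ℝ => g (s : UnitAddCircle)) 1 := fun s =>
      congrArg g (AddCircle.coe_add_period 1 s)
    beta_reduce
    rw [← intervalIntegral.integral_add_adjacent_intervals (hint a t) (hint t (t + 1)),
      hg1.intervalIntegral_add_eq t a, h0, add_zero]
  refine ⟨hper.lift, mem_Lip_of_abs_le (C := C) fun s t => ?_, fun t => hper.lift_coe t⟩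
  rw [hper.lift_coe, hper.lift_coe,
    intervalIntegral.integral_interval_sub_left (hint a s) (hint a t), abs_sub_comm]
  exact abs_integral_coe_le hC t s

variable {T τ : UnitAddCircle → UnitAddCircle} {S R : ℝ → ℝ} {K : ℝ} {k : ℤ} {r : ℝ≥0}

namespace IsExpandingLift

/-- A one-sided limit of a section of `T` is a preimage, and the section is given by a branch
of the inverse of `T` near it. -/
lemma eventually_eq_branch (hL : IsExpandingLift T S R K k) (hτ : ∀ x, T (τ x) = x)
    {l : Filter ℝ} [l.NeBot] (hl : l ≤ 𝓝 0) {s v : ℝ}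
    (h : Tendsto (fun h : ℝ => τ ((s : UnitAddCircle) + (h : UnitAddCircle))) l
      (𝓝 (v : UnitAddCircle))) :
    ((S v : ℝ) : UnitAddCircle) = (s : UnitAddCircle) ∧
      ∀ᶠ h in l, τ ((s + h : ℝ) : UnitAddCircle) = ((R (S v + h) : ℝ) : UnitAddCircle) := by
  have hcoe : Tendsto (fun h : ℝ => ((s + h : ℝ) : UnitAddCircle)) l (𝓝 (s : UnitAddCircle)) := by
    have : Continuous fun h : ℝ => ((s + h : ℝ) : UnitAddCircle) :=
      continuous_coe.comp (continuous_const.add continuous_id)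
    have := this.tendsto 0
    rw [add_zero] at this
    exact this.mono_left hl
  have hSv : ((S v : ℝ) : UnitAddCircle) = (s : UnitAddCircle) := by
    rw [hL.coe_lift]
    refine tendsto_nhds_unique ((hL.continuous_map.tendsto _).comp h) (hcoe.congr fun t => ?_)
    simp only [Function.comp, hτ, AddCircle.coe_add]
  refine ⟨hSv, ?_⟩
  obtain ⟨ε, hε, hinj⟩ := hL.exists_injective
  have hR : Tendsto (fun h : ℝ => ((R (S v + h) : ℝ) : UnitAddCircle)) l
      (𝓝 (v : UnitAddCircle)) := by
    have : Continuous fun h : ℝ => ((R (S v + h) : ℝ) : UnitAddCircle) :=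
      continuous_coe.comp (hL.continuous_inv.comp (continuous_const.add continuous_id))
    have := this.tendsto 0
    rw [add_zero, hL.left_inv] at this
    exact this.mono_left hl
  -- Both points tend to v and have the same image under T, so local injectivity identifies them
  -- once they are closer than ε.
  filter_upwards [(h.dist hR).eventually_lt_const (by simpa using hε)] with t ht
  rw [AddCircle.coe_add]
  refine hinj _ _ ht ?_
  rw [hτ, hL.map_coe_inv, AddCircle.coe_add, hSv]

/-- Along a branch, the integral of `transfer H` is the integral of `H` over the image. -/
lemma integral_transfer_branch (hL : IsExpandingLift T S R K k)
    (hsec : IsContractingSection volume T τ r) {H : UnitAddCircle → ℝ} (hH : Measurable H)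
    {a b w : ℝ} (hab : a ≤ b) (hb : b ≤ a + 1)
    (hbr : ∀ t ∈ Set.Ioo a b, τ (t : UnitAddCircle) = ((R (t + w) : ℝ) : UnitAddCircle)) :
    ∫ s in a..b, hsec.transfer H (s : UnitAddCircle)
      = ∫ s in R (a + w)..R (b + w), H (s : UnitAddCircle) := by
  have h1 : R (a + w) ≤ R (b + w) := hL.strictMono_inv.monotone (by linarith)
  have h2 : R (b + w) ≤ R (a + w) + 1 := by
    have := hL.inv_sub_le_sub (s := a + w) (t := b + w) (by linarith)
    linarith
  rw [← setIntegral_coe_image_Ioo hab hb (hsec.measurable_transfer hH),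
    ← setIntegral_coe_image_Ioo h1 h2 hH,
    hsec.setIntegral_transfer hH (measurableSet_coe_image measurableSet_Ioo (Ioo_subset_Ioc_add_one hb))]
  congr 2
  ext x
  constructor
  · rintro ⟨_, ⟨t, ht, rfl⟩, rfl⟩
    refine ⟨R (t + w), ⟨hL.strictMono_inv ?_, hL.strictMono_inv ?_⟩, (hbr t ht).symm⟩ <;>
      linarith [ht.1, ht.2]
  · rintro ⟨v, ⟨hv1, hv2⟩, rfl⟩
    rw [← hL.strictMono.lt_iff_lt, hL.right_inv] at hv1 hv2
    have ht : S v - w ∈ Set.Ioo a b := ⟨by linarith, by linarith⟩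
    exact ⟨_, ⟨S v - w, ht, rfl⟩, by rw [hbr _ ht, sub_add_cancel, hL.left_inv]⟩

/-- Just to the right of s the section is a single inverse branch, so the change of variables
applies. With its left-hand counterpart this shows one side at a time that the error in the
flattening equation is locally constant. -/
lemma eventually_right (hL : IsExpandingLift T S R K k)
    (hsec : IsContractingSection volume T τ r) {H : UnitAddCircle → ℝ} (hH : Measurable H)
    {s v : ℝ} (h : Tendsto (fun h : ℝ => τ ((s : UnitAddCircle) + (h : UnitAddCircle)))
      (𝓝[>] 0) (𝓝 (v : UnitAddCircle))) :
    ∀ᶠ h in 𝓝[>] (0 : ℝ), τ ((s + h : ℝ) : UnitAddCircle) = ((R (S v + h) : ℝ) : UnitAddCircle) ∧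
      ∫ t in s..(s + h), hsec.transfer H (t : UnitAddCircle)
        = ∫ t in v..R (S v + h), H (t : UnitAddCircle) := by
  obtain ⟨-, h2⟩ := hL.eventually_eq_branch hsec.rightInverse nhdsWithin_le_nhds h
  obtain ⟨δ, hδ, hsub⟩ := (mem_nhdsGT_iff_exists_Ioo_subset).1 h2
  filter_upwards [h2, Ioo_mem_nhdsGT (lt_min hδ one_pos)] with t ht1 ht2
  refine ⟨ht1, ?_⟩
  have h3 := hL.integral_transfer_branch hsec hH (a := s) (b := s + t) (w := S v - s)
    (by linarith [ht2.1]) (by linarith [ht2.2, min_le_right δ 1]) fun x hx => by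
      have h4 : x - s ∈ Set.Ioo 0 δ :=
        ⟨by linarith [hx.1], by linarith [hx.2, ht2.2, min_le_left δ 1]⟩
      have h5 := hsub h4
      simp only [Set.mem_ofPred_eq] at h5
      rw [add_sub_cancel] at h5
      rw [h5]; congr 2; ring
  rw [h3, add_sub_cancel, hL.left_inv]
  congr 2; ring

lemma eventually_left (hL : IsExpandingLift T S R K k)
    (hsec : IsContractingSection volume T τ r) {H : UnitAddCircle → ℝ} (hH : Measurable H)
    {s v : ℝ} (h : Tendsto (fun h : ℝ => τ ((s : UnitAddCircle) + (h : UnitAddCircle)))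
      (𝓝[<] 0) (𝓝 (v : UnitAddCircle))) :
    ∀ᶠ h in 𝓝[<] (0 : ℝ), τ ((s + h : ℝ) : UnitAddCircle) = ((R (S v + h) : ℝ) : UnitAddCircle) ∧
      ∫ t in s..(s + h), hsec.transfer H (t : UnitAddCircle)
        = ∫ t in v..R (S v + h), H (t : UnitAddCircle) := by
  obtain ⟨-, h2⟩ := hL.eventually_eq_branch hsec.rightInverse nhdsWithin_le_nhds h
  obtain ⟨δ, hδ, hsub⟩ := (mem_nhdsLT_iff_exists_Ioo_subset).1 h2
  filter_upwards [h2, Ioo_mem_nhdsLT (max_lt hδ neg_one_lt_zero)] with t ht1 ht2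
  refine ⟨ht1, ?_⟩
  have h3 := hL.integral_transfer_branch hsec hH (a := s + t) (b := s) (w := S v - s)
    (by linarith [ht2.2]) (by linarith [ht2.1, le_max_right δ (-1)]) fun x hx => by
      have h4 : x - s ∈ Set.Ioo δ 0 :=
        ⟨by linarith [hx.1, ht2.1, le_max_left δ (-1)], by linarith [hx.2]⟩
      have h5 := hsub h4
      simp only [Set.mem_ofPred_eq] at h5
      rw [add_sub_cancel] at h5
      rw [h5]; congr 2; ring
  rw [intervalIntegral.integral_symm, h3, add_sub_cancel, hL.left_inv,
    ← intervalIntegral.integral_symm]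
  congr 2; ring

lemma tendsto_branch (hL : IsExpandingLift T S R K k) (v : ℝ) {l : Filter ℝ} (hl : l ≤ 𝓝 0) :
    Tendsto (fun h => R (S v + h)) l (𝓝 v) := by
  have : Continuous fun h : ℝ => R (S v + h) :=
    hL.continuous_inv.comp (continuous_const.add continuous_id)
  have := this.tendsto 0
  rw [add_zero, hL.left_inv] at this
  exact this.mono_left hl

end IsExpandingLift

/-- Treats jumps and points of continuity uniformly, so that local arguments need no case
distinction. -/
lemma IsPreimageSelector.exists_sideLimits (hτ : IsPreimageSelector T τ) (x : UnitAddCircle) :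
    ∃ l r : UnitAddCircle,
      Tendsto (fun s : ℝ => τ (x + (s : UnitAddCircle))) (𝓝[<] 0) (𝓝 l) ∧
      Tendsto (fun s : ℝ => τ (x + (s : UnitAddCircle))) (𝓝[>] 0) (𝓝 r) ∧
      (x ∈ discontinuities τ ∨ l = r) ∧ (τ x = l ∨ τ x = r) := by
  by_cases hx : x ∈ discontinuities τ
  · obtain ⟨l, r, hl, hr, -, h⟩ := hτ.2.2 x hx
    exact ⟨l, r, hl, hr, Or.inl hx, h⟩
  · have hc : ContinuousAt τ x := by simpa [discontinuities] using hx
    have h1 : Tendsto (fun s : ℝ => τ (x + (s : UnitAddCircle))) (𝓝 0) (𝓝 (τ x)) := by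
      have h2 : Tendsto (fun s : ℝ => x + (s : UnitAddCircle)) (𝓝 0) (𝓝 x) := by
        have h3 : Continuous fun s : ℝ => x + (s : UnitAddCircle) :=
          continuous_const.add continuous_coe
        have h4 := h3.tendsto 0
        rwa [AddCircle.coe_zero, add_zero] at h4
      exact hc.tendsto.comp h2
    exact ⟨τ x, τ x, h1.mono_left nhdsWithin_le_nhds, h1.mono_left nhdsWithin_le_nhds,
      Or.inr rfl, Or.inl rfl⟩

lemma leftLim_eq {x l : UnitAddCircle}
    (h : Tendsto (fun s : ℝ => τ (x + (s : UnitAddCircle))) (𝓝[<] 0) (𝓝 l)) : leftLim τ x = l :=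
  h.limUnder_eq

lemma rightLim_eq {x l : UnitAddCircle}
    (h : Tendsto (fun s : ℝ => τ (x + (s : UnitAddCircle))) (𝓝[>] 0) (𝓝 l)) : rightLim τ x = l :=
  h.limUnder_eq

end

/-! ### The arcs I_x in coordinates; flattening forces the functionals to vanish -/

section

lemma eventually_nhds_of_sides {p : ℝ → Prop} {t : ℝ} (hl : ∀ᶠ h in 𝓝[<] (0 : ℝ), p (t + h))
    (hr : ∀ᶠ h in 𝓝[>] (0 : ℝ), p (t + h)) (h0 : p t) : ∀ᶠ s in 𝓝 t, p s := by
  have h1 : ∀ᶠ h in 𝓝 (0 : ℝ), p (t + h) := by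
    rw [← pure_sup_nhdsNE, ← nhdsLT_sup_nhdsGT, eventually_sup, eventually_sup]
    exact ⟨by simpa using h0, hl, hr⟩
  have h2 : Tendsto (fun s => s - t) (𝓝 t) (𝓝 0) :=
    (continuous_sub_right t).tendsto' t 0 (sub_self t)
  filter_upwards [h2.eventually h1] with s hs
  simpa using hs

lemma eq_of_eventually_eq {f : ℝ → ℝ} {U : Set ℝ} (hU : IsOpen U) (hU' : IsPreconnected U)
    (h : ∀ t ∈ U, ∀ᶠ s in 𝓝 t, f s = f t) {s t : ℝ} (hs : s ∈ U) (ht : t ∈ U) : f s = f t := by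
  have hd : ∀ t ∈ U, HasDerivAt f 0 t := fun t ht =>
    (hasDerivAt_const t (f t)).congr_of_eventuallyEq (h t ht)
  obtain ⟨a, ha⟩ := hU.exists_is_const_of_deriv_eq_zero hU'
    (fun t ht => (hd t ht).differentiableAt.differentiableWithinAt) fun t ht => (hd t ht).deriv
  rw [ha s hs, ha t ht]

/-- The representative in `[a, a + 1)` of a point of the circle. -/
def rep (a : ℝ) (x : UnitAddCircle) : ℝ := (AddCircle.equivIco (1 : ℝ) a x : ℝ)

lemma rep_mem (a : ℝ) (x : UnitAddCircle) : rep a x ∈ Set.Ico a (a + 1) :=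
  (AddCircle.equivIco (1 : ℝ) a x).2

@[simp] lemma coe_rep (a : ℝ) (x : UnitAddCircle) : ((rep a x : ℝ) : UnitAddCircle) = x :=
  AddCircle.coe_equivIco

lemma rep_coe {a s : ℝ} (hs : s ∈ Set.Ico a (a + 1)) : rep a (s : UnitAddCircle) = s := by
  rw [rep, AddCircle.equivIco_coe_of_mem hs]

lemma rep_injective (a : ℝ) : Function.Injective (rep a) := fun x y h => by
  rw [← coe_rep a x, h, coe_rep]

lemma measurable_rep (a : ℝ) : Measurable (rep a) :=
  measurable_subtype_coe.comp (AddCircle.measurableEquivIco (1 : ℝ) a).measurable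

lemma arcLength_coe {s t : ℝ} (hst : s ≤ t) (hts : t < s + 1) :
    arcLength (s : UnitAddCircle) (t : UnitAddCircle) = t - s := by
  rw [arcLength, ← AddCircle.coe_sub]
  exact rep_coe (a := 0) ⟨by linarith, by linarith⟩

lemma closedArc_coe {s t : ℝ} (hst : s ≤ t) (hts : t < s + 1) :
    closedArc (s : UnitAddCircle) (t : UnitAddCircle) = (↑) '' Set.Icc s t := by
  ext x
  obtain ⟨h1, h2⟩ := rep_mem s x
  have h3 : arcLength (s : UnitAddCircle) x = rep s x - s := by
    conv_lhs => rw [← coe_rep s x]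
    exact arcLength_coe h1 h2
  simp only [closedArc, Set.mem_ofPred_eq, h3, arcLength_coe hst hts]
  constructor
  · exact fun h => ⟨rep s x, ⟨h1, by linarith⟩, coe_rep s x⟩
  · rintro ⟨u, hu, rfl⟩
    rw [rep_coe ⟨hu.1, hu.2.trans_lt hts⟩]
    linarith [hu.2]

variable {T τ : UnitAddCircle → UnitAddCircle} {S R : ℝ → ℝ} {K : ℝ} {k : ℤ} {r : ℝ≥0}

/-- In the coordinate with values in [a, a + 1), cut at y(x₁), no arc crosses the cut. Both
orientations in the definition become the interval between two representatives. -/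
lemma arcI_eq {a : ℝ} {x₁ : UnitAddCircle} (ha : (a : UnitAddCircle) = rightLim τ x₁)
    (x : UnitAddCircle) :
    arcI τ x₁ x = (↑) '' Set.uIcc (rep a (rightLim τ x)) (rep a (leftLim τ x)) := by
  have hcut : ∀ u, arcLength (rightLim τ x₁) u = rep a u - a := fun u => by
    obtain ⟨h1, h2⟩ := rep_mem a u
    conv_lhs => rw [← ha, ← coe_rep a u]
    exact arcLength_coe h1 h2
  obtain ⟨h1, h2⟩ := rep_mem a (rightLim τ x)
  obtain ⟨h3, h4⟩ := rep_mem a (leftLim τ x)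
  simp only [arcI, CutLT, hcut, sub_lt_sub_iff_right]
  split_ifs with h
  · rw [Set.uIcc_of_le h.le]
    conv_lhs => rw [← coe_rep a (rightLim τ x), ← coe_rep a (leftLim τ x)]
    exact closedArc_coe h.le (by linarith)
  · push Not at h
    rw [Set.uIcc_of_ge h]
    conv_lhs => rw [← coe_rep a (rightLim τ x), ← coe_rep a (leftLim τ x)]
    exact closedArc_coe h (by linarith)

lemma measurableSet_arcI (τ : UnitAddCircle → UnitAddCircle) (x₁ x : UnitAddCircle) :
    MeasurableSet (arcI τ x₁ x) := by
  rw [arcI_eq (coe_rep 0 _)]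
  exact (isCompact_uIcc.image continuous_coe).measurableSet

/-- The sign σ = ±1 records which endpoint comes first; only σ² = 1 is used later. -/
lemma exists_setIntegral_arcI {a : ℝ} {x₁ : UnitAddCircle}
    (ha : (a : UnitAddCircle) = rightLim τ x₁) (x : UnitAddCircle) :
    ∃ σ : ℝ, σ * σ = 1 ∧ ∀ u : UnitAddCircle → ℝ, Measurable u →
      ∫ t in arcI τ x₁ x, u t
        = σ * ∫ s in rep a (rightLim τ x)..rep a (leftLim τ x), u (s : UnitAddCircle) := by
  obtain ⟨h1, h2⟩ := rep_mem a (rightLim τ x)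
  obtain ⟨h3, h4⟩ := rep_mem a (leftLim τ x)
  rw [arcI_eq ha]
  rcases le_total (rep a (rightLim τ x)) (rep a (leftLim τ x)) with h | h
  · refine ⟨1, by norm_num, fun u hu => ?_⟩
    rw [Set.uIcc_of_le h, setIntegral_coe_image_Icc h (by linarith) hu, one_mul]
  · refine ⟨-1, by norm_num, fun u hu => ?_⟩
    rw [Set.uIcc_of_ge h, setIntegral_coe_image_Icc h (by linarith) hu,
      intervalIntegral.integral_symm]
    ring

/-- The one-sided limits of a selector at a discontinuity. -/
lemma IsPreimageSelector.tendsto_sideLimits (hτ : IsPreimageSelector T τ) {x : UnitAddCircle}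
    (hx : x ∈ discontinuities τ) :
    Tendsto (fun s : ℝ => τ (x + (s : UnitAddCircle))) (𝓝[<] 0) (𝓝 (leftLim τ x)) ∧
    Tendsto (fun s : ℝ => τ (x + (s : UnitAddCircle))) (𝓝[>] 0) (𝓝 (rightLim τ x)) ∧
    leftLim τ x ≠ rightLim τ x ∧ (τ x = leftLim τ x ∨ τ x = rightLim τ x) := by
  obtain ⟨l, r, hl, hr, hlr, h⟩ := hτ.2.2 x hx
  rw [leftLim_eq hl, rightLim_eq hr]
  exact ⟨hl, hr, hlr, h⟩

lemma tendsto_add_coe (x : UnitAddCircle) {l : Filter ℝ} (hl : l ≤ 𝓝 0) :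
    Tendsto (fun s : ℝ => x + (s : UnitAddCircle)) l (𝓝 x) := by
  have h3 : Continuous fun s : ℝ => x + (s : UnitAddCircle) :=
    continuous_const.add continuous_coe
  have h4 := h3.tendsto 0
  rw [AddCircle.coe_zero, add_zero] at h4
  exact h4.mono_left hl

lemma map_sideLimit (hT : Continuous T) (hτ : ∀ x, T (τ x) = x) {l : Filter ℝ} [l.NeBot]
    (hl : l ≤ 𝓝 0) {x z : UnitAddCircle}
    (h : Tendsto (fun s : ℝ => τ (x + (s : UnitAddCircle))) l (𝓝 z)) : T z = x := by
  refine tendsto_nhds_unique ((hT.tendsto z).comp h) ?_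
  refine (tendsto_add_coe x hl).congr fun s => ?_
  simp only [Function.comp, hτ]

/-- An everywhere continuous section would have degree `1 / k`. -/
lemma IsExpandingLift.discontinuities_nonempty (hL : IsExpandingLift T S R K k)
    (hτ : ∀ x, T (τ x) = x) : (discontinuities τ).Nonempty := by
  by_contra! hD
  have hc : Continuous τ := continuous_iff_continuousAt.2 fun x => by
    by_contra hx
    exact Set.notMem_empty x (hD ▸ hx)
  set v := rep 0 (τ ((0 : ℝ) : UnitAddCircle))
  -- M is where τ follows the inverse branch chosen at 0. It is clopen, so the branch is followed
  -- around the whole circle.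
  set M : Set ℝ := {t | τ (t : UnitAddCircle) = ((R (t + S v) : ℝ) : UnitAddCircle)} with hM
  have hclosed : IsClosed M := isClosed_eq (hc.comp continuous_coe)
    (continuous_coe.comp (hL.continuous_inv.comp (continuous_id.add continuous_const)))
  have hopen : IsOpen M := isOpen_iff_mem_nhds.2 fun t ht => by
    have h1 : Tendsto (fun h : ℝ => τ ((t : UnitAddCircle) + (h : UnitAddCircle))) (𝓝 0)
        (𝓝 ((R (t + S v) : ℝ) : UnitAddCircle)) := by
      have h2 := (hc.tendsto _).comp (tendsto_add_coe (t : UnitAddCircle) le_rfl)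
      rwa [show τ (t : UnitAddCircle) = _ from ht] at h2
    have h3 := (hL.eventually_eq_branch hτ le_rfl h1).2
    have h4 : Tendsto (fun s => s - t) (𝓝 t) (𝓝 0) :=
    (continuous_sub_right t).tendsto' t 0 (sub_self t)
    filter_upwards [h4.eventually h3] with s hs
    rw [hL.right_inv, add_sub_cancel] at hs
    change τ (s : UnitAddCircle) = _
    rw [hs]
    congr 2
    ring
  have huniv : M = Set.univ := IsClopen.eq_univ ⟨hclosed, hopen⟩ ⟨0, by
    change τ ((0 : ℝ) : UnitAddCircle) = _
    rw [zero_add, hL.left_inv, coe_rep]⟩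
  have h0 : (0 : ℝ) ∈ M := huniv ▸ Set.mem_univ _
  have h1 : (1 : ℝ) ∈ M := huniv ▸ Set.mem_univ _
  have h2 : ((R (1 + S v) : ℝ) : UnitAddCircle) = ((R (0 + S v) : ℝ) : UnitAddCircle) := by
    rw [← show τ _ = _ from h0, ← show τ _ = _ from h1]
    congr 1
    exact coe_eq_coe_iff.2 ⟨1, by norm_num⟩
  -- After one turn the branch has moved by an integer n; applying S gives 1 = n k, impossible for k
  -- ≥ 2.
  obtain ⟨n, hn⟩ := coe_eq_coe_iff.1 h2
  have h3 := congrArg S hn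
  rw [hL.add_intCast, hL.right_inv, hL.right_inv] at h3
  have h4 : (1 : ℤ) = n * k := by
    have : (1 : ℝ) = n * k := by linarith
    exact_mod_cast this
  have h5 := hL.two_le
  have h6 : k ∣ 1 := ⟨n, by rw [h4, mul_comm]⟩
  have := Int.le_of_dvd one_pos h6
  omega

/-- The functionals vanish on functions that can be flattened. -/
lemma IsExpandingLift.integral_eq_zero_of_flatten (hL : IsExpandingLift T S R K k)
    (hτ : IsPreimageSelector T τ) {f φ : UnitAddCircle → ℝ} (hf : f ∈ Lip) (hφ : φ ∈ Lip) {c : ℝ}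
    (hc : ∀ x, f (τ x) + φ (τ x) - φ x = c) (x₁ : UnitAddCircle) {x : UnitAddCircle}
    (hx : x ∈ discontinuities τ) :
    ∫ t, (density τ x₁ x t).toReal * circleDeriv f t = 0 := by
  have hsec := hL.isContractingSection hτ
  obtain ⟨Cf, hCf⟩ := exists_abs_circleDeriv_le hf
  obtain ⟨Cφ, hCφ⟩ := exists_abs_circleDeriv_le hφ
  have hfc := continuous_of_mem_Lip hf
  have hφc := continuous_of_mem_Lip hφ
  set H : UnitAddCircle → ℝ := fun t => circleDeriv f t + circleDeriv φ t with hH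
  have hHm : Measurable H := (measurable_circleDeriv f).add (measurable_circleDeriv φ)
  have hHb : ∀ t, |H t| ≤ Cf + Cφ := fun t =>
    (abs_add_le _ _).trans (add_le_add (hCf t) (hCφ t))
  have hQm := hsec.measurable_transfer hHm
  have hQb := hsec.abs_transfer_le hHb
  have hint : ∀ s t : ℝ, ∫ w in s..t, H (w : UnitAddCircle)
      = f t + φ t - (f s + φ s) := fun s t => by
    rw [hH]
    simp only
    rw [intervalIntegral.integral_add
      (intervalIntegrable_coe (measurable_circleDeriv f) hCf s t)
      (intervalIntegrable_coe (measurable_circleDeriv φ) hCφ s t),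
      integral_circleDeriv hf, integral_circleDeriv hφ]
    ring
  have hlim : ∀ {l : Filter ℝ} [l.NeBot], l ≤ 𝓝 0 → ∀ {y z : UnitAddCircle},
      Tendsto (fun s : ℝ => τ (y + (s : UnitAddCircle))) l (𝓝 z) → f z + φ z - φ y = c := by
    intro l _ hl y z h
    have h1 := (((hfc.add hφc).tendsto z).comp h).sub
      ((hφc.tendsto y).comp (tendsto_add_coe y hl))
    refine tendsto_nhds_unique h1 (tendsto_const_nhds.congr fun s => ?_)
    simp only [Function.comp]
    exact (hc _).symm
  -- The integrated form of φ' = Q(f' + φ'). The difference of the two sides is locally constant: at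
  -- each point, jumps included, both one-sided limits satisfy the flattening equation.
  have hW : ∀ t : ℝ, φ (t : UnitAddCircle)
      = φ ((0 : ℝ) : UnitAddCircle) + ∫ s in (0 : ℝ)..t, hsec.transfer H (s : UnitAddCircle) := by
    set Ψ : ℝ → ℝ := fun t => φ (t : UnitAddCircle)
      - ∫ s in (0 : ℝ)..t, hsec.transfer H (s : UnitAddCircle) with hΨ
    have hQi := intervalIntegrable_coe hQm hQb
    have key : ∀ t : ℝ, ∀ᶠ s in 𝓝 t, Ψ s = Ψ t := fun t => by
      have side : ∀ {h v : ℝ}, f v + φ v - φ t = c →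
          (τ ((t + h : ℝ) : UnitAddCircle) = ((R (S v + h) : ℝ) : UnitAddCircle) ∧
          ∫ s in t..(t + h), hsec.transfer H (s : UnitAddCircle)
            = ∫ s in v..R (S v + h), H (s : UnitAddCircle)) → Ψ (t + h) = Ψ t := by
        rintro h v hv ⟨h1, h2⟩
        rw [hint] at h2
        have h3 := hc ((t + h : ℝ) : UnitAddCircle)
        rw [h1] at h3
        have h4 := intervalIntegral.integral_add_adjacent_intervals (hQi 0 t) (hQi t (t + h))
        simp only [hΨ]
        linarith
      obtain ⟨l, r, hl, hr, -, -⟩ := hτ.exists_sideLimits (t : UnitAddCircle)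
      rw [← coe_rep 0 l] at hl
      rw [← coe_rep 0 r] at hr
      refine eventually_nhds_of_sides ?_ ?_ rfl
      · exact (hL.eventually_left hsec hHm hl).mono fun h => side (hlim nhdsWithin_le_nhds hl)
      · exact (hL.eventually_right hsec hHm hr).mono fun h => side (hlim nhdsWithin_le_nhds hr)
    intro t
    have h1 : Ψ t = Ψ 0 := eq_of_eventually_eq isOpen_univ isPreconnected_univ
      (fun t _ => key t) (Set.mem_univ t) (Set.mem_univ 0)
    simp only [hΨ, intervalIntegral.integral_same] at h1
    linarith
  have hae : ∀ᵐ t, circleDeriv f t = H t - hsec.transfer H t := by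
    filter_upwards [circleDeriv_ae_eq hQm hQb hW] with t ht
    rw [← ht, hH]
    ring
  obtain ⟨hl, hr, -, -⟩ := hτ.tendsto_sideLimits hx
  obtain ⟨σ, -, hσ⟩ := exists_setIntegral_arcI (coe_rep 0 (rightLim τ x₁)) x
  -- `density τ x₁ x` is by definition `visits τ (arcI τ x₁ x)`.
  have h1 := hsec.integral_visits_mul (measurableSet_arcI τ x₁ x) hHm hHb hae
  rw [hσ H hHm, hint, coe_rep, coe_rep] at h1
  have h2 := hlim nhdsWithin_le_nhds hl
  have h3 := hlim nhdsWithin_le_nhds hr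
  rw [show f (leftLim τ x) + φ (leftLim τ x) - (f (rightLim τ x) + φ (rightLim τ x)) = 0 by
    linarith, mul_zero] at h1
  exact h1

end

/-! ### Vanishing of the functionals suffices for flattening -/

section

variable {T τ : UnitAddCircle → UnitAddCircle} {S R : ℝ → ℝ} {K : ℝ} {k : ℤ} {r : ℝ≥0}

/-- Functions annihilated by all functionals can be flattened. -/
lemma IsExpandingLift.exists_flatten (hL : IsExpandingLift T S R K k)
    (hτ : IsPreimageSelector T τ) {f : UnitAddCircle → ℝ} (hf : f ∈ Lip) {x₁ : UnitAddCircle}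
    (hx₁ : x₁ ∈ discontinuities τ)
    (h0 : ∀ x ∈ discontinuities τ, ∫ t, (density τ x₁ x t).toReal * circleDeriv f t = 0) :
    ∃ φ ∈ Lip, ∃ c : ℝ, ∀ x, f (τ x) + φ (τ x) - φ x = c := by
  have hsec := hL.isContractingSection hτ
  obtain ⟨Cf, hCf⟩ := exists_abs_circleDeriv_le hf
  obtain ⟨H, hHm, ⟨C, hHb⟩, hH⟩ := hsec.exists_eq_add_transfer (measurable_circleDeriv f) hCf
  have hQm := hsec.measurable_transfer hHm
  have hQb := hsec.abs_transfer_le hHb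
  have hHi := intervalIntegrable_coe hHm hHb
  have hQi := intervalIntegrable_coe hQm hQb
  set a : ℝ := rep 0 (rightLim τ x₁) with ha
  have ha' : (a : UnitAddCircle) = rightLim τ x₁ := coe_rep 0 _
  set b : ℝ := S a with hb
  obtain ⟨hl₁, hr₁, hlr₁, hτ₁⟩ := hτ.tendsto_sideLimits hx₁
  have hb' : (b : UnitAddCircle) = x₁ := by
    rw [hb, hL.coe_lift, ha']
    exact map_sideLimit hL.continuous_map hτ.1 nhdsWithin_le_nhds hr₁
  set G : ℝ → ℝ := fun t => ∫ s in a..t, H (s : UnitAddCircle) with hG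
  set W : ℝ → ℝ := fun t => ∫ s in b..t, hsec.transfer H (s : UnitAddCircle) with hW
  -- By telescoping, the hypothesis says that the integral of H over I_x is zero: G agrees at the
  -- two endpoints.
  have hjump : ∀ x ∈ discontinuities τ, G (rep a (leftLim τ x)) = G (rep a (rightLim τ x)) := by
    intro x hx
    obtain ⟨σ, hσ1, hσ⟩ := exists_setIntegral_arcI ha' x
    have h1 := hsec.integral_visits_mul (measurableSet_arcI τ x₁ x) hHm hHb
      (ae_of_all _ fun t => eq_sub_of_add_eq (hH t).symm)
    have h2 : σ * ∫ s in rep a (rightLim τ x)..rep a (leftLim τ x), H (s : UnitAddCircle) = 0 := by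
      rw [← hσ H hHm, ← h1]
      exact h0 x hx
    have h3 : σ ≠ 0 := fun h => by simp [h] at hσ1
    have h4 := (mul_eq_zero.1 h2).resolve_left h3
    rw [← intervalIntegral.integral_interval_sub_left (hHi a _) (hHi a _)] at h4
    exact sub_eq_zero.1 h4
  have hGa : G a = 0 := intervalIntegral.integral_same
  have hrepa : rep a (rightLim τ x₁) = a := by
    rw [← ha']
    exact rep_coe ⟨le_rfl, by linarith⟩
  have hGl : G (rep a (leftLim τ x₁)) = 0 := by rw [hjump x₁ hx₁, hrepa, hGa]
  have hGr : G (rep a (rightLim τ x₁)) = 0 := by rw [hrepa, hGa]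
  -- The error in the flattening equation: G is to become f + φ and W to become φ, each up to a
  -- constant.
  set Ψ : ℝ → ℝ := fun t => G (rep a (τ (t : UnitAddCircle))) - W t with hΨ
  have side : ∀ {l : Filter ℝ} {t v : ℝ},
      (∀ᶠ h in l, R (S v + h) ∈ Set.Ico a (a + 1)) →
      (∀ᶠ h in l, τ ((t + h : ℝ) : UnitAddCircle) = ((R (S v + h) : ℝ) : UnitAddCircle) ∧
        ∫ s in t..(t + h), hsec.transfer H (s : UnitAddCircle)
          = ∫ s in v..R (S v + h), H (s : UnitAddCircle)) →
      ∀ᶠ h in l, Ψ (t + h) = G v - W t := by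
    intro l t v hmem hev
    filter_upwards [hmem, hev] with h h1 h2
    simp only [hΨ]
    rw [h2.1, rep_coe h1]
    have h3 := intervalIntegral.integral_add_adjacent_intervals (hHi a v) (hHi v (R (S v + h)))
    have h4 := intervalIntegral.integral_add_adjacent_intervals (hQi b t) (hQi t (t + h))
    simp only [hG, hW]
    linarith [h2.2]
  -- The coordinate `rep a` jumps only at y(x₁); near any other limit z the branch stays inside the
  -- window [a, a + 1).
  have hIco : ∀ {z : UnitAddCircle}, z ≠ rightLim τ x₁ → ∀ {l : Filter ℝ}, l ≤ 𝓝 0 →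
      ∀ᶠ h in l, R (S (rep a z) + h) ∈ Set.Ico a (a + 1) := fun {z} hz {l} hl => by
    have h1 := rep_mem a z
    have h2 : a ≠ rep a z := fun h => hz (by rw [← ha', h, coe_rep])
    exact (hL.tendsto_branch (rep a z) hl).eventually
      (Ico_mem_nhds (lt_of_le_of_ne h1.1 h2) h1.2)
  have hconst : ∀ t ∈ Set.Ioo b (b + 1), ∀ᶠ s in 𝓝 t, Ψ s = Ψ t := fun t ht => by
    obtain ⟨l, r, hl, hr, hlr, hτt⟩ := hτ.exists_sideLimits (t : UnitAddCircle)
    -- T maps a one-sided limit at t to t, so y(x₁) can be a limit only at x₁, which is not in the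
    -- open period (b, b + 1).
    have hne : ∀ {l : Filter ℝ} [l.NeBot] {z : UnitAddCircle}, l ≤ 𝓝 0 →
        Tendsto (fun s : ℝ => τ ((t : UnitAddCircle) + (s : UnitAddCircle))) l (𝓝 z) →
        z ≠ rightLim τ x₁ := fun hl h hz => by
      have h1 := map_sideLimit hL.continuous_map hτ.1 hl h
      rw [hz, map_sideLimit hL.continuous_map hτ.1 nhdsWithin_le_nhds hr₁, ← hb'] at h1
      have h2 := (AddCircle.coe_eq_coe_iff_of_mem_Ico (a := b) ⟨le_rfl, by linarith⟩
        ⟨ht.1.le, ht.2⟩).1 h1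
      exact ht.1.ne h2
    have hGlr : G (rep a l) = G (rep a r) := by
      rcases hlr with hx | rfl
      · have := hjump _ hx
        rwa [leftLim_eq hl, rightLim_eq hr] at this
      · rfl
    have hΨt : Ψ t = G (rep a r) - W t := by
      simp only [hΨ]
      rcases hτt with h | h <;> rw [h]
      rw [hGlr]
    have hl' := hl
    have hr' := hr
    rw [← coe_rep a l] at hl'
    rw [← coe_rep a r] at hr'
    refine eventually_nhds_of_sides ?_ ?_ rfl
    · rw [hΨt, ← hGlr]
      exact side (hIco (hne nhdsWithin_le_nhds hl) nhdsWithin_le_nhds)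
        (hL.eventually_left hsec hHm hl')
    · rw [hΨt]
      exact side (hIco (hne nhdsWithin_le_nhds hr) nhdsWithin_le_nhds)
        (hL.eventually_right hsec hHm hr')
  have hconst' : ∀ {s t : ℝ}, s ∈ Set.Ioo b (b + 1) → t ∈ Set.Ioo b (b + 1) → Ψ s = Ψ t :=
    fun hs ht => eq_of_eventually_eq isOpen_Ioo isPreconnected_Ioo hconst hs ht
  have hWb : W b = 0 := intervalIntegral.integral_same
  have hzero : ∀ {t : ℝ}, t ∈ Set.Ioo b (b + 1) → Ψ t = 0 := fun {t} ht => by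
    have h1 : ∀ᶠ h in 𝓝[>] (0 : ℝ), R (S a + h) ∈ Set.Ico a (a + 1) := by
      have h2 := (hL.tendsto_branch a (nhdsWithin_le_nhds (s := Set.Ioi 0))).eventually
        (Iio_mem_nhds (show a < a + 1 by linarith))
      filter_upwards [h2, self_mem_nhdsWithin] with h h3 h4
      refine ⟨?_, h3⟩
      have h5 := hL.strictMono_inv.monotone (show S a ≤ S a + h by
        linarith [show (0 : ℝ) < h from h4])
      rwa [hL.left_inv] at h5
    have hr' := hr₁
    rw [← ha', ← hb'] at hr'
    obtain ⟨h, h2, h3⟩ := ((side h1 (hL.eventually_right hsec hHm hr')).and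
      (Ioo_mem_nhdsGT (zero_lt_one (α := ℝ)))).exists
    rw [hGa, hWb, sub_zero] at h2
    rw [← h2]
    exact hconst' ht ⟨by linarith [h3.1], by linarith [h3.2]⟩
  -- Periodicity of φ is the condition at x₁: to the left of b + 1 the section tends to y'(x₁),
  -- where G vanishes as it does at y(x₁).
  have hWb1 : W (b + 1) = 0 := by
    have hb1 : ((b + 1 : ℝ) : UnitAddCircle) = x₁ := (AddCircle.coe_add_period 1 b).trans hb'
    have hl' := hl₁
    rw [← coe_rep a (leftLim τ x₁)] at hl'
    nth_rewrite 1 [← hb1] at hl'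
    obtain ⟨h, h2, h3⟩ := ((side (hIco hlr₁ nhdsWithin_le_nhds)
      (hL.eventually_left hsec hHm hl')).and
      (Ioo_mem_nhdsLT (neg_one_lt_zero (R := ℝ)))).exists
    rw [hzero ⟨by linarith [h3.1], by linarith [h3.2]⟩, hGl] at h2
    linarith
  obtain ⟨φ, hφ, hφW⟩ := exists_primitive hQm hQb hWb1
  refine ⟨φ, hφ, f (a : UnitAddCircle) + φ (a : UnitAddCircle), fun x => ?_⟩
  have hGφ : ∀ t : ℝ, G t = f t - f a + (φ t - φ a) := fun t => by
    have h1 : G t = ∫ s in a..t, (circleDeriv f (s : UnitAddCircle)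
        + hsec.transfer H (s : UnitAddCircle)) :=
      intervalIntegral.integral_congr fun s _ => hH _
    rw [h1, intervalIntegral.integral_add
      (intervalIntegrable_coe (measurable_circleDeriv f) hCf a t) (hQi a t),
      integral_circleDeriv hf, hφW, hφW,
      intervalIntegral.integral_interval_sub_left (hQi b t) (hQi b a)]
  have hφx : φ x = G (rep a (τ x)) := by
    obtain ⟨h1, h2⟩ := rep_mem b x
    rcases h1.eq_or_lt with h3 | h3
    · have hx : x = x₁ := by rw [← hb', h3, coe_rep]
      have h4 : φ x = 0 := by
        rw [hx, ← hb', hφW]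
        exact hWb
      rw [h4, hx]
      rcases hτ₁ with h | h <;> rw [h]
      · exact hGl.symm
      · exact hGr.symm
    · have h4 := hzero ⟨h3, h2⟩
      simp only [hΨ, hW, ← hφW, coe_rep] at h4
      linarith
  rw [hφx, hGφ, coe_rep]
  ring

end

/-! ### Simultaneous prescription of the values of the functionals -/

section

variable {T τ : UnitAddCircle → UnitAddCircle} {S R : ℝ → ℝ} {K : ℝ} {k : ℤ} {r : ℝ≥0}

/-- A function with prescribed integrals over the arcs `arcI τ x₁ x`. -/
lemma exists_prescribed_integrals (hD : (discontinuities τ).Finite)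
    (hne : ∀ x ∈ discontinuities τ, ∀ x' ∈ discontinuities τ, leftLim τ x ≠ rightLim τ x')
    (hinj : Set.InjOn (leftLim τ) (discontinuities τ)) {a : ℝ} {x₁ : UnitAddCircle}
    (ha : (a : UnitAddCircle) = rightLim τ x₁) (c : UnitAddCircle → ℝ) :
    ∃ g : UnitAddCircle → ℝ, Measurable g ∧ (∃ C, ∀ t, |g t| ≤ C) ∧
      ∀ x ∈ discontinuities τ, ∫ t in arcI τ x₁ x, g t = c x := by
  classical
  choose σ hσ1 hσ using fun x => exists_setIntegral_arcI ha x
  set D := hD.toFinset with hDdef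
  set N : Finset ℝ := D.image (fun x => rep a (leftLim τ x)) ∪
    D.image (fun x => rep a (rightLim τ x)) with hN
  -- The integrand will be the derivative of a polynomial interpolating these values: σ c at the
  -- representative of y'(x) and 0 at that of y(x). All these nodes can be told apart because T maps
  -- them back to x and the two limits at x differ.
  set val : ℝ → ℝ := fun s => ∑ x ∈ D, if s = rep a (leftLim τ x) then σ x * c x else 0 with hval
  set P : Polynomial ℝ := Lagrange.interpolate N id val with hP
  have hPv : ∀ s ∈ N, P.eval s = val s := fun s hs =>
    Lagrange.eval_interpolate_at_node val (Set.injOn_id _) hs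
  refine ⟨fun t => P.derivative.eval (rep a t),
    P.derivative.continuous.measurable.comp (measurable_rep a), ?_, fun x hx => ?_⟩
  · obtain ⟨C, hC⟩ := (isCompact_Icc (a := a) (b := a + 1)).exists_bound_of_continuousOn
      P.derivative.continuous.continuousOn
    exact ⟨C, fun t => hC _ (Set.Ico_subset_Icc_self (rep_mem a t))⟩
  · have hxD : x ∈ D := hD.mem_toFinset.2 hx
    rw [hσ x (fun t => P.derivative.eval (rep a t))
      (P.derivative.continuous.measurable.comp (measurable_rep a))]
    have h1 : ∫ s in rep a (rightLim τ x)..rep a (leftLim τ x),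
        P.derivative.eval (rep a (s : UnitAddCircle))
        = ∫ s in rep a (rightLim τ x)..rep a (leftLim τ x), P.derivative.eval s := by
      refine intervalIntegral.integral_congr fun s hs => ?_
      rw [rep_coe]
      have h2 := rep_mem a (rightLim τ x)
      have h3 := rep_mem a (leftLim τ x)
      exact ⟨(le_min h2.1 h3.1).trans hs.1, hs.2.trans_lt (max_lt h2.2 h3.2)⟩
    rw [h1, intervalIntegral.integral_eq_sub_of_hasDerivAt (fun s _ => P.hasDerivAt s)
      (P.derivative.continuous.intervalIntegrable _ _),
      hPv _ (Finset.mem_union_left _ (Finset.mem_image_of_mem _ hxD)),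
      hPv _ (Finset.mem_union_right _ (Finset.mem_image_of_mem _ hxD))]
    have h4 : val (rep a (leftLim τ x)) = σ x * c x := by
      rw [hval]
      simp only
      rw [Finset.sum_eq_single_of_mem x hxD, if_pos rfl]
      intro y hy hyx
      refine if_neg fun h => hyx ?_
      exact (hinj hx (hD.mem_toFinset.1 hy) (rep_injective a h)).symm
    have h5 : val (rep a (rightLim τ x)) = 0 := by
      refine Finset.sum_eq_zero fun y hy => if_neg fun h => ?_
      exact hne y (hD.mem_toFinset.1 hy) x hx (rep_injective a h).symm
    rw [h4, h5, sub_zero, ← mul_assoc, hσ1, one_mul]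

/-- There is a nontrivial arc that avoids the range of `τ` and all the arcs `arcI τ x₁ x`. -/
lemma IsExpandingLift.exists_gap (hL : IsExpandingLift T S R K k)
    (hτ : IsPreimageSelector T τ) {x₁ : UnitAddCircle} (hx₁ : x₁ ∈ discontinuities τ) :
    ∃ J : Set UnitAddCircle, MeasurableSet J ∧ volume.real J ≠ 0 ∧ Disjoint J (Set.range τ) ∧
      ∀ x ∈ discontinuities τ, Disjoint J (arcI τ x₁ x) := by
  set a : ℝ := rep 0 (rightLim τ x₁) with ha
  have ha' : (a : UnitAddCircle) = rightLim τ x₁ := coe_rep 0 _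
  obtain ⟨hl₁, hr₁, hlr₁, -⟩ := hτ.tendsto_sideLimits hx₁
  have hTa : ((S a : ℝ) : UnitAddCircle) = x₁ := by
    rw [hL.coe_lift, ha']
    exact map_sideLimit hL.continuous_map hτ.1 nhdsWithin_le_nhds hr₁
  -- A point just left of y(x₁) has its image just left of x₁, which τ sends close to y'(x₁) ≠
  -- y(x₁). So τ does not return to the point, which therefore is not in the range.
  have h1 : ∀ᶠ h in 𝓝[<] (0 : ℝ), ((a + 1 + h : ℝ) : UnitAddCircle) ∉ Set.range τ := by
    have hS : Tendsto (fun h => S (a + h) - S a) (𝓝[<] 0) (𝓝[<] 0) := by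
      refine tendsto_nhdsWithin_iff.2 ⟨?_, ?_⟩
      · have h2 : Continuous fun h => S (a + h) - S a :=
          (hL.continuous_lift.comp (continuous_const.add continuous_id)).sub continuous_const
        exact (h2.tendsto' 0 0 (by simp)).mono_left nhdsWithin_le_nhds
      · filter_upwards [self_mem_nhdsWithin] with h hh
        exact sub_neg.2 (hL.strictMono (by linarith [show h < 0 from hh]))
    have h2 := (hl₁.comp hS)
    have h3 := (tendsto_add_coe (a : UnitAddCircle)
      (nhdsWithin_le_nhds (a := (0 : ℝ)) (s := Set.Iio 0)))
    rw [ha'] at h3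
    have h4 := (h2.prodMk_nhds h3).eventually (isClosed_diagonal.isOpen_compl.mem_nhds hlr₁)
    filter_upwards [h4] with h hh
    rintro ⟨y, hy⟩
    have h5 : ((a + 1 + h : ℝ) : UnitAddCircle) = ((a + h : ℝ) : UnitAddCircle) :=
      coe_eq_coe_iff.2 ⟨1, by push_cast; ring⟩
    rw [h5] at hy
    apply hh
    simp only [Function.comp, Set.mem_diagonal_iff]
    rw [← ha', ← hTa, ← AddCircle.coe_add, ← AddCircle.coe_add, add_sub_cancel, hL.coe_lift, ← hy,
      hτ.1]
  -- The arc I_x ends strictly before a + 1 in the window [a, a + 1), leaving room just below a + 1.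
  have h2 : ∀ x ∈ discontinuities τ, ∀ᶠ h in 𝓝[<] (0 : ℝ),
      ((a + 1 + h : ℝ) : UnitAddCircle) ∉ arcI τ x₁ x := fun x _ => by
    have h3 : max (rep a (rightLim τ x)) (rep a (leftLim τ x)) < a + 1 :=
      max_lt (rep_mem _ _).2 (rep_mem _ _).2
    filter_upwards [Ioo_mem_nhdsLT (max_lt (sub_neg.2 h3) neg_one_lt_zero)] with h hh
    rw [arcI_eq ha']
    rintro ⟨s, hs, hsh⟩
    have h4 : s ∈ Set.Ico a (a + 1) :=
      ⟨(le_min (rep_mem _ _).1 (rep_mem _ _).1).trans hs.1, hs.2.trans_lt h3⟩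
    have h8 := le_max_right (max (rep a (rightLim τ x)) (rep a (leftLim τ x)) - (a + 1)) (-1)
    have h5 : a + 1 + h ∈ Set.Ico a (a + 1) := ⟨by linarith [hh.1], by linarith [hh.2]⟩
    have h6 := (AddCircle.coe_eq_coe_iff_of_mem_Ico h4 h5).1 hsh
    have h7 := le_max_left (max (rep a (rightLim τ x)) (rep a (leftLim τ x)) - (a + 1)) (-1)
    linarith [hh.1, show s ≤ max (rep a (rightLim τ x)) (rep a (leftLim τ x)) from hs.2]
  obtain ⟨δ, hδ, hsub⟩ := mem_nhdsLT_iff_exists_Ioo_subset.1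
    (h1.and ((Filter.eventually_all_finite hτ.2.1).2 h2))
  set d := max δ (-1) with hd
  have hd0 : d < 0 := max_lt hδ neg_one_lt_zero
  have hd1 : -1 ≤ d := le_max_right _ _
  have hbd : a + 1 ≤ a + 1 + d + 1 := by linarith
  have hJ : ∀ z ∈ ((↑) : ℝ → UnitAddCircle) '' Set.Ioo (a + 1 + d) (a + 1),
      z ∉ Set.range τ ∧ ∀ x ∈ discontinuities τ, z ∉ arcI τ x₁ x := by
    rintro _ ⟨s, hs, rfl⟩
    have h3 : s - (a + 1) ∈ Set.Ioo δ 0 :=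
      ⟨by linarith [hs.1, le_max_left δ (-1)], by linarith [hs.2]⟩
    have h4 := hsub h3
    simp only [Set.mem_ofPred_eq] at h4
    rwa [add_sub_cancel] at h4
  refine ⟨_, measurableSet_coe_image measurableSet_Ioo (Ioo_subset_Ioc_add_one hbd), ?_,
    Set.disjoint_left.2 fun z hz => (hJ z hz).1,
    fun x hx => Set.disjoint_left.2 fun z hz => (hJ z hz).2 x hx⟩
  have h3 := setIntegral_coe_image_Ioo (a := a + 1 + d) (b := a + 1) (by linarith) hbd
    (u := fun _ => (1 : ℝ)) measurable_const
  simp only [integral_const, smul_eq_mul, mul_one, intervalIntegral.integral_const,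
    measureReal_restrict_apply_univ] at h3
  rw [h3]
  linarith

/-- The functionals take arbitrary values simultaneously. -/
lemma IsExpandingLift.exists_integral_eq (hL : IsExpandingLift T S R K k)
    (hτ : IsPreimageSelector T τ) {x₁ : UnitAddCircle} (hx₁ : x₁ ∈ discontinuities τ)
    (c : UnitAddCircle → ℝ) :
    ∃ f ∈ Lip, ∀ x ∈ discontinuities τ,
      ∫ t, (density τ x₁ x t).toReal * circleDeriv f t = c x := by
  classical
  have hsec := hL.isContractingSection hτ
  have hTl : ∀ x ∈ discontinuities τ, T (leftLim τ x) = x := fun x hx =>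
    map_sideLimit hL.continuous_map hτ.1 nhdsWithin_le_nhds (hτ.tendsto_sideLimits hx).1
  have hTr : ∀ x ∈ discontinuities τ, T (rightLim τ x) = x := fun x hx =>
    map_sideLimit hL.continuous_map hτ.1 nhdsWithin_le_nhds (hτ.tendsto_sideLimits hx).2.1
  obtain ⟨g₀, hg₀m, ⟨C, hg₀b⟩, hg₀⟩ := exists_prescribed_integrals hτ.2.1
    (fun x hx x' hx' h => by
      have h1 : x = x' := by rw [← hTl x hx, h, hTr x' hx']
      subst h1
      exact (hτ.tendsto_sideLimits hx).2.2.1 h)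
    (fun x hx y hy h => by rw [← hTl x hx, h, hTl y hy]) (coe_rep 0 (rightLim τ x₁)) c
  obtain ⟨J, hJm, hJ0, hJτ, hJI⟩ := hL.exists_gap hτ hx₁
  -- The height on J that cancels the integral off the range of τ; J misses every I_x, so the
  -- prescribed integrals are kept.
  set κ : ℝ := -(∫ t in (Set.range τ)ᶜ, g₀ t) / volume.real J with hκ
  set g : UnitAddCircle → ℝ := fun t => g₀ t + J.indicator (fun _ => κ) t with hg
  have hχm : Measurable (J.indicator fun _ => κ) := measurable_const.indicator hJm
  have hχb : ∀ t, |J.indicator (fun _ => κ) t| ≤ |κ| := fun t => by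
    by_cases ht : t ∈ J <;> simp [ht]
  have hgm : Measurable g := hg₀m.add hχm
  have hgb : ∀ t, |g t| ≤ C + |κ| := fun t =>
    (abs_add_le _ _).trans (add_le_add (hg₀b t) (hχb t))
  have hi : ∀ {u : UnitAddCircle → ℝ}, Measurable u → ∀ {B : ℝ}, (∀ t, |u t| ≤ B) →
      Integrable u := fun hu B hB => Integrable.of_bound hu.aestronglyMeasurable B (ae_of_all _ hB)
  have hgA : ∀ A, ∫ t in A, g t = (∫ t in A, g₀ t) + κ * volume.real (J ∩ A) := fun A => by
    rw [hg, integral_add (hi hg₀m hg₀b).integrableOn (hi hχm hχb).integrableOn,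
      integral_indicator_const κ hJm, measureReal_restrict_apply hJm, smul_eq_mul, mul_comm κ]
  have hgI : ∀ x ∈ discontinuities τ, ∫ t in arcI τ x₁ x, g t = c x := fun x hx => by
    rw [hgA, hg₀ x hx, (hJI x hx).inter_eq]
    simp
  have hgF : ∫ t in (Set.range τ)ᶜ, g t = 0 := by
    rw [hgA, Set.inter_eq_left.2 (Set.subset_compl_iff_disjoint_right.2 hJτ), hκ]
    field_simp
    ring
  have hQm := hsec.measurable_transfer hgm
  have hQb := hsec.abs_transfer_le hgb
  have hum : Measurable fun t => g t - hsec.transfer g t := hgm.sub hQm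
  have hub : ∀ t, |g t - hsec.transfer g t| ≤ C + |κ| + (K⁻¹).toNNReal * (C + |κ|) := fun t =>
    (abs_sub _ _).trans (add_le_add (hgb t) (hQb t))
  -- The total integral of g - Q g is that of g off the range of τ, hence zero; this lets the
  -- primitive close up on the circle.
  have hu0 : ∫ s in (0 : ℝ)..(0 + 1), (g (s : UnitAddCircle) - hsec.transfer g s) = 0 := by
    have h1 := UnitAddCircle.intervalIntegral_preimage 0 fun t => g t - hsec.transfer g t
    rw [h1, integral_sub (hi hgm hgb) (hi hQm hQb)]
    have h2 := hsec.setIntegral_transfer hgm MeasurableSet.univ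
    rw [setIntegral_univ, Set.image_univ] at h2
    rw [h2, ← integral_add_compl hsec.measurableSet_range (hi hgm hgb), hgF]
    ring
  obtain ⟨f, hf, hfu⟩ := exists_primitive hum hub hu0
  refine ⟨f, hf, fun x hx => ?_⟩
  rw [← hgI x hx]
  exact hsec.integral_visits_mul (measurableSet_arcI τ x₁ x) hgm hgb
    (circleDeriv_ae_eq hum hub (c := 0) fun t => by rw [hfu, zero_add])

end

/-! ### Linear algebra: the functionals, their common kernel and the codimension -/

section

variable {T τ : UnitAddCircle → UnitAddCircle} {S R : ℝ → ℝ} {K : ℝ} {k : ℤ} {r : ℝ≥0}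

/-- Additivity can fail where a summand is not differentiable and its derivative defaults to 0,
hence the almost everywhere statement. -/
lemma circleDeriv_add_ae {f g : UnitAddCircle → ℝ} (hf : f ∈ Lip) (hg : g ∈ Lip) :
    ∀ᵐ x, circleDeriv (f + g) x = circleDeriv f x + circleDeriv g x := by
  obtain ⟨C, hC⟩ := exists_abs_circleDeriv_le hf
  obtain ⟨D, hD⟩ := exists_abs_circleDeriv_le hg
  have hfm := measurable_circleDeriv f
  have hgm := measurable_circleDeriv g
  refine circleDeriv_ae_eq (f := f + g) (C := C + D) (a := 0)
    (c := f ((0 : ℝ) : UnitAddCircle) + g ((0 : ℝ) : UnitAddCircle)) (hfm.add hgm)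
    (fun x => (abs_add_le _ _).trans (add_le_add (hC x) (hD x))) fun t => ?_
  rw [intervalIntegral.integral_add (intervalIntegrable_coe hfm hC _ _)
    (intervalIntegrable_coe hgm hD _ _), integral_circleDeriv hf, integral_circleDeriv hg,
    Pi.add_apply]
  ring

lemma circleDeriv_smul (c : ℝ) (f : UnitAddCircle → ℝ) (x : UnitAddCircle) :
    circleDeriv (c • f) x = c * circleDeriv f x := by
  simp only [circleDeriv, Pi.smul_apply, smul_eq_mul]
  exact deriv_const_mul_field c

/-- The functional `f ↦ ∫ e f'` for a density `e` that is integrable against bounded functions. -/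
def derivFunctional (e : UnitAddCircle → ℝ)
    (he : ∀ f ∈ Lip, Integrable fun t => e t * circleDeriv f t) : Module.Dual ℝ Lip where
  toFun f := ∫ t, e t * circleDeriv f t
  map_add' f g := by
    rw [← integral_add (he _ f.2) (he _ g.2)]
    refine integral_congr_ae ?_
    filter_upwards [circleDeriv_add_ae f.2 g.2] with t ht
    rw [Submodule.coe_add, ht]
    ring
  map_smul' c f := by
    simp only [Submodule.coe_smul, circleDeriv_smul, RingHom.id_apply, smul_eq_mul]
    rw [← integral_const_mul]
    congr 1
    funext t
    ring

/-- Substitute t = τ x; the equation then extends to the closure by continuity. -/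
lemma canLipschitzFlatten_closure_range_iff (hT : Continuous T) (hτ : ∀ x, T (τ x) = x)
    {f : UnitAddCircle → ℝ} (hf : f ∈ Lip) :
    CanLipschitzFlatten T (closure (Set.range τ)) f ↔
      ∃ φ ∈ Lip, ∃ c : ℝ, ∀ x, f (τ x) + φ (τ x) - φ x = c := by
  refine exists_congr fun φ => and_congr_right fun hφ => exists_congr fun c => ?_
  constructor
  · intro h x
    have := h (τ x) (subset_closure ⟨x, rfl⟩)
    rwa [hτ] at this
  · intro h
    have hφc := continuous_of_mem_Lip hφ
    have hcl : IsClosed {t | f t + φ t - φ (T t) = c} :=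
      isClosed_eq (((continuous_of_mem_Lip hf).add hφc).sub (hφc.comp hT)) continuous_const
    refine fun t ht => closure_minimal (t := {t | f t + φ t - φ (T t) = c}) ?_ hcl ht
    rintro _ ⟨x, rfl⟩
    change f (τ x) + φ (τ x) - φ (T (τ x)) = c
    rw [hτ, h]

/-- The functions that can be flattened on `F` form a subspace. -/
def lipFlatSubmodule (T : UnitAddCircle → UnitAddCircle) (F : Set UnitAddCircle) :
    Submodule ℝ Lip where
  carrier := LipFlat T F
  add_mem' := by
    rintro f g ⟨φ, hφ, c, hc⟩ ⟨ψ, hψ, d, hd⟩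
    refine ⟨φ + ψ, Lip.add_mem hφ hψ, c + d, fun t ht => ?_⟩
    rw [← hc t ht, ← hd t ht]
    simp only [Submodule.coe_add, Pi.add_apply]
    ring
  zero_mem' := ⟨0, Lip.zero_mem, 0, fun t _ => by simp⟩
  smul_mem' := by
    rintro a f ⟨φ, hφ, c, hc⟩
    refine ⟨a • φ, Lip.smul_mem a hφ, a * c, fun t ht => ?_⟩
    rw [← hc t ht]
    simp only [Submodule.coe_smul, Pi.smul_apply, smul_eq_mul]
    ring

lemma IsExpandingLift.integrable_density_mul (hL : IsExpandingLift T S R K k)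
    (hτ : IsPreimageSelector T τ) (x₁ x : UnitAddCircle) :
    ∀ f ∈ Lip, Integrable fun t => (density τ x₁ x t).toReal * circleDeriv f t := fun f hf => by
  obtain ⟨C, hC⟩ := exists_abs_circleDeriv_le hf
  exact (hL.isContractingSection hτ).integrable_visits_mul (measurableSet_arcI τ x₁ x)
    (measurable_circleDeriv f) hC

/-- The functional `f ↦ ∫ e_x f'`. -/
def IsExpandingLift.petalFunctional (hL : IsExpandingLift T S R K k)
    (hτ : IsPreimageSelector T τ) (x₁ : UnitAddCircle) (x : discontinuities τ) :
    Module.Dual ℝ Lip :=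
  derivFunctional (fun t => (density τ x₁ x t).toReal) (hL.integrable_density_mul hτ x₁ x)

lemma IsExpandingLift.petalFunctional_apply (hL : IsExpandingLift T S R K k)
    (hτ : IsPreimageSelector T τ) (x₁ : UnitAddCircle) (x : discontinuities τ) (f : Lip) :
    hL.petalFunctional hτ x₁ x f = ∫ t, (density τ x₁ x t).toReal * circleDeriv f t := rfl

lemma IsExpandingLift.pi_petalFunctional_surjective (hL : IsExpandingLift T S R K k)
    (hτ : IsPreimageSelector T τ) {x₁ : UnitAddCircle} (hx₁ : x₁ ∈ discontinuities τ) :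
    Function.Surjective (LinearMap.pi (hL.petalFunctional hτ x₁)) := fun c => by
  classical
  obtain ⟨f, hf, hfc⟩ := hL.exists_integral_eq hτ hx₁
    fun x => if hx : x ∈ discontinuities τ then c ⟨x, hx⟩ else 0
  refine ⟨⟨f, hf⟩, funext fun x => ?_⟩
  rw [LinearMap.pi_apply, petalFunctional_apply, hfc x x.2, dif_pos x.2]

/-- A vanishing combination, evaluated at a preimage of the i-th basis vector, has i-th coefficient
zero. -/
lemma linearIndependent_of_pi_surjective {ι 𝕜 E : Type*} [Finite ι] [Field 𝕜] [AddCommGroup E]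
    [Module 𝕜 E] {L : ι → Module.Dual 𝕜 E} (h : Function.Surjective (LinearMap.pi L)) :
    LinearIndependent 𝕜 L := by
  classical
  have := Fintype.ofFinite ι
  refine Fintype.linearIndependent_iff.2 fun g hg i => ?_
  obtain ⟨f, hf⟩ := h (Pi.single i 1)
  have hfi : ∀ j, L j f = (Pi.single i 1 : ι → 𝕜) j := fun j => by rw [← hf, LinearMap.pi_apply]
  have h1 := LinearMap.congr_fun hg f
  simpa [LinearMap.sum_apply, hfi, Pi.single_apply] using h1

lemma IsExpandingLift.lipFlatSubmodule_eq (hL : IsExpandingLift T S R K k)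
    (hτ : IsPreimageSelector T τ) {x₁ : UnitAddCircle} (hx₁ : x₁ ∈ discontinuities τ) :
    lipFlatSubmodule T (closure (Set.range τ))
      = ⨅ x, LinearMap.ker (hL.petalFunctional hτ x₁ x) := by
  ext f
  change CanLipschitzFlatten T _ (f : UnitAddCircle → ℝ) ↔ _
  rw [canLipschitzFlatten_closure_range_iff hL.continuous_map hτ.1 f.2, Submodule.mem_iInf]
  simp only [LinearMap.mem_ker, petalFunctional_apply]
  constructor
  · rintro ⟨φ, hφ, c, hc⟩ x
    exact hL.integral_eq_zero_of_flatten hτ f.2 hφ hc x₁ x.2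
  · exact fun h => hL.exists_flatten hτ f.2 hx₁ fun x hx => h ⟨x, hx⟩

/-- The quotient by the common kernel is the space of real functions on the discontinuities. The
left side involves τ only through the closure of its range, so two selectors of the same flower have
equally many discontinuities. -/
lemma IsExpandingLift.rank_quotient (hL : IsExpandingLift T S R K k)
    (hτ : IsPreimageSelector T τ) :
    Module.rank ℝ (Lip ⧸ lipFlatSubmodule T (closure (Set.range τ)))
      = (discontinuities τ).ncard := by
  obtain ⟨x₁, hx₁⟩ := hL.discontinuities_nonempty hτ.1
  have : Fintype (discontinuities τ) := hτ.2.1.fintype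
  rw [hL.lipFlatSubmodule_eq hτ hx₁, ← LinearMap.ker_pi,
    (LinearMap.quotKerEquivOfSurjective _ (hL.pi_petalFunctional_surjective hτ hx₁)).rank_eq,
    rank_fun', Set.ncard_eq_toFinset_card', Set.toFinset_card]

lemma IsExpandingLift.density_facts (hL : IsExpandingLift T S R K k)
    (hτ : IsPreimageSelector T τ) (x₁ x : UnitAddCircle) :
    Measurable (density τ x₁ x) ∧ ∫⁻ t, density τ x₁ x t < ∞ :=
  ⟨(hL.isContractingSection hτ).measurable_visits (measurableSet_arcI τ x₁ x),
    (hL.isContractingSection hτ).lintegral_visits_lt_top (measurableSet_arcI τ x₁ x)⟩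

lemma integral_withDensity_circleDeriv {e : UnitAddCircle → ℝ≥0∞} (he : Measurable e)
    (hi : ∫⁻ t, e t < ∞) {f : UnitAddCircle → ℝ}
    (hf : Integrable fun t => (e t).toReal * circleDeriv f t) :
    Integrable (circleDeriv f) (volume.withDensity e) ∧
      ∫ t, (e t).toReal * circleDeriv f t = ∫ t, circleDeriv f t ∂(volume.withDensity e) := by
  have hlt := ae_lt_top he hi.ne
  constructor
  · rw [integrable_withDensity_iff_integrable_smul' he hlt]
    exact hf
  · rw [integral_withDensity_eq_integral_toReal_smul he hlt]
    rfl

end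

end

end Flower

theorem mainTheorem2 (T : UnitAddCircle → UnitAddCircle)
    (hT : Flower.IsOrientationPreservingExpanding T)
    (hTLip : ∃ C : ℝ≥0, LipschitzWith C T)
    (p : ℕ) (F : Set UnitAddCircle) (hF : Flower.IsFlower T p F) :
    ∃ V : Submodule ℝ Flower.Lip,
      (V : Set Flower.Lip) = Flower.LipFlat T F ∧
      Module.rank ℝ (Flower.Lip ⧸ V) = p ∧
      ∀ τ : UnitAddCircle → UnitAddCircle,
        Flower.IsPreimageSelector T τ → closure (Set.range τ) = F →
        (Flower.discontinuities τ).ncard = p ∧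
        ∀ x₁ ∈ Flower.discontinuities τ,
          (∀ x ∈ Flower.discontinuities τ,
            AEMeasurable (Flower.density τ x₁ x) volume ∧
            ∫⁻ t, Flower.density τ x₁ x t < ∞) ∧
          ∃ L : Flower.discontinuities τ → Module.Dual ℝ Flower.Lip,
            (∀ (x : Flower.discontinuities τ) (f : Flower.Lip),
              Integrable (fun t => (Flower.density τ x₁ x t).toReal * Flower.circleDeriv f t) ∧
              L x f = ∫ t, (Flower.density τ x₁ x t).toReal * Flower.circleDeriv f t) ∧
            (∀ (x : Flower.discontinuities τ) (f : Flower.Lip),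
              Integrable (Flower.circleDeriv f) (volume.withDensity (Flower.density τ x₁ x)) ∧
              L x f = ∫ t, Flower.circleDeriv f t ∂(volume.withDensity (Flower.density τ x₁ x))) ∧
            LinearIndependent ℝ L ∧
            V = ⨅ x, LinearMap.ker (L x) := by
  obtain ⟨S, R, K, k, hL⟩ := Flower.exists_isExpandingLift hT
  obtain ⟨-, τ₀, hτ₀, hp, hF⟩ := hF
  have hrank : Module.rank ℝ (Flower.Lip ⧸ Flower.lipFlatSubmodule T F) = p := by
    rw [hF, hL.rank_quotient hτ₀, hp]
  refine ⟨Flower.lipFlatSubmodule T F, rfl, hrank, fun τ hτ hτF => ⟨?_, fun x₁ hx₁ => ?_⟩⟩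
  · rw [← hτF, hL.rank_quotient hτ] at hrank
    exact_mod_cast hrank
  refine ⟨fun x _ => ⟨(hL.density_facts hτ x₁ x).1.aemeasurable, (hL.density_facts hτ x₁ x).2⟩,
    hL.petalFunctional hτ x₁, fun x f => ⟨hL.integrable_density_mul hτ x₁ x f f.2, rfl⟩,
    fun x f => ?_, ?_, ?_⟩
  · obtain ⟨h1, h2⟩ := hL.density_facts hτ x₁ x
    exact Flower.integral_withDensity_circleDeriv h1 h2
      (hL.integrable_density_mul hτ x₁ x f f.2)
  · have := hτ.2.1.to_subtype
    exact Flower.linearIndependent_of_pi_surjective (hL.pi_petalFunctional_surjective hτ hx₁)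
  · rw [← hτF]
    exact hL.lipFlatSubmodule_eq hτ hx₁
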